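/- **Setting.** There are $N=Gm$ clients ($G,m\ge 1$), of which $B$ are Byzantine and the others honest; $\mathcal H$ is the set of honest clients. Client $n$ has a finite non-empty dataset with points $\xi_{n,1},\dots,\xi_{n,m_n}$ and a loss $f_n(w,\xi)$, $w\in\mathbb R^p$, differentiable in $w$ if $n$ is honest. Write $f'_{n,j}(w)=\nabla_w f_n(w,\xi_{n,j})$, $f_n(w)=\frac1{m_n}\sum_j f_n(w,\xi_{n,j})$, and $f=\frac1{|\mathcal H|}\sum_{n\in\mathcal H}f_n$; let $w^*$ be a minimizer of $f$. **Algorithm (ROTAF with $s$-resampling, $s\ge1$).** The initial model $w_0$ is deterministic. At round $t$ the following are drawn, independently of each other and of the past: a uniformly random division of the clients into $G$ groups $\mathcal G_{t,1},\dots,\mathcal G_{t,G}$ of $m$ clients; for each client $n$ a uniform index $j_n^t\in\{1,\dots,m_n\}$; noises $\tilde z_{t,g}\sim\mathcal N(0,\sigma^2I_p)$, $g=1,\dots,G$; and a resampling, that is, a uniformly random distribution of the $Gs$ items consisting of $s$ copies of each $g\in\{1,\dots,G\}$ into $G$ multisets $\mathcal S_{t,1},\dots,\mathcal S_{t,G}$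 of $s$ items each. An honest client $n$ sends $m_t^n=-\eta f'_{n,j_n^t}(w_t)$; a Byzantine client sends an arbitrary vector $m_t^n$, which may depend on the past and on all the randomness of round $t$. All clients have channel magnitude above the threshold $h_{\min}>0$ and so transmit. With $P>0$ and $\rho_t=\sqrt{P/\max_{n\in\mathcal H}\mathbb E\|m_t^n\|^2}$, the server receives $y_{t,g}=\sum_{n\in\mathcal G_{t,g}}\rho_th_{\min}m_t^n+\tilde z_{t,g}$ and forms $u_g^t=y_{t,g}/(\rho_th_{\min}m)$ (if the maximum is $0$, then $u_g^t=0$), $\tilde u_k^t=\frac1s\sum_{g\in\mathcal S_{t,k}}u_g^t$ (with multiplicity), and $w_{t+1}=w_t+\mathrm{geomed}(\tilde u_1^t,\dots,\tilde u_G^t)$, where $\mathrm{geomed}(v_1,\dots,v_G)$ is any minimizer of $z\mapsto\sum_k\|z-v_k\|$. **Assumptions.** For some $\mu,L>0$ and some $\delta,\kappa,K$: (i) $f(x)\ge f(y)+\langle f'(y),x-y\rangle+\frac\mu2\|x-y\|^2$ for all $x,y\in\mathbb R^p$; (ii) $\|f'(x)-f'(y)\|\le L\|x-y\|$ for all $x,y\in\mathbb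 R^p$; (iii) $\|f_n'(x)-f'(x)\|^2\le\delta^2$ for every honest $n$ and all $x\in\mathbb R^p$; (iv) $\mathbb E\|f'_{n,j}(x)-f_n'(x)\|^2\le\kappa^2$, with $j$ uniform in $\{1,\dots,m_n\}$, for every honest $n$ and all $x\in\mathbb R^p$; (v) $\mathbb E\|f'_{n,j_n^t}(w_t)\|^2\le K^2$ for every honest $n$ and every round $t$. **Theorem.** If $B<\frac G{2s}$ and $0<\eta<\min\left(\frac\mu{2L^2},\frac2\mu\right)$, then for every $t\ge0$ the expectation below is finite and $$\mathbb E\|w_t-w^*\|^2\le(1-\eta\mu)^tB_2+A_2,$$ where $$B_2=\|w_0-w^*\|^2-A_2,\qquad A_2=\frac2{\mu^2}C_{s\alpha}^2\left(d+\frac{1-d}{G-B}\right)\left(\delta^2+\kappa^2+\frac{p\sigma^2}{mPh_{\min}^2}K^2\right),$$ with $C_{s\alpha}=\frac{2-2s\alpha}{1-2s\alpha}$, $\alpha=\frac BG$ and $d=\frac{G-1}{sG-1}$ (if $G=s=1$, where $d$ is undefined, the factor $d+\frac{1-d}{G-B}$ is $1$). -/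

import Mathlib

open MeasureTheory ProbabilityTheory
open scoped BigOperators InnerProductSpace

namespace ROTAF

noncomputable section

/-- The parameter space `ℝ^p` with its Euclidean norm. -/
abbrev Param (p : ℕ) : Type := EuclideanSpace ℝ (Fin p)

/-- `N` clients with finite non-empty local datasets, their local losses `(w, ξ) ↦ f_n(w, ξ)`, and
the set of those clients that are Byzantine. -/
structure Federation (p N : ℕ) (Ξ : Type*) where
  size : Fin N → ℕ
  size_pos : ∀ n, 0 < size n
  data : ∀ n, Fin (size n) → Ξ
  loss : Fin N → Param p → Ξ → ℝ
  byz : Finset (Fin N)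

variable {p N : ℕ} {Ξ : Type*}

namespace Federation

variable (F : Federation p N Ξ)

/-- The number `B` of Byzantine clients. -/
def numByz : ℕ := F.byz.card

/-- `f_n(x)`: the expectation of `f_n(x, ξ)` for `ξ` uniform in the local dataset of client `n`. -/
def localLoss (n : Fin N) (x : Param p) : ℝ :=
  (∑ j : Fin (F.size n), F.loss n x (F.data n j)) / F.size n

/-- The global loss `f`: the average of the local losses of the honest clients. -/
def globalLoss (x : Param p) : ℝ :=
  (∑ n ∈ F.byzᶜ, F.localLoss n x) / (F.byzᶜ.card : ℝ)

/-- `f'_{n,j}(x)`: the stochastic gradient of client `n` computed from its sample `j`. -/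
def stochGrad (n : Fin N) (j : Fin (F.size n)) (x : Param p) : Param p :=
  gradient (fun y => F.loss n y (F.data n j)) x

/-- The losses of the honest clients are differentiable in the parameter. -/
def DifferentiableLosses : Prop :=
  ∀ n ∉ F.byz, ∀ j : Fin (F.size n), Differentiable ℝ (fun x => F.loss n x (F.data n j))

/-- `f` is `μ`-strongly convex. -/
def StronglyConvex (μ : ℝ) : Prop :=
  ∀ x y : Param p,
    F.globalLoss x ≥ F.globalLoss y + ⟪gradient F.globalLoss y, x - y⟫_ℝ + μ / 2 * ‖x - y‖ ^ 2

/-- `f` has `L`-Lipschitz gradient. -/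
def LipschitzGradient (L : ℝ) : Prop :=
  ∀ x y : Param p, ‖gradient F.globalLoss x - gradient F.globalLoss y‖ ≤ L * ‖x - y‖

/-- Bounded outer variation: `‖f_n'(x) - f'(x)‖² ≤ δ²` for every honest client `n`. -/
def BoundedOuterVariation (δ : ℝ) : Prop :=
  ∀ n ∉ F.byz, ∀ x : Param p,
    ‖gradient (F.localLoss n) x - gradient F.globalLoss x‖ ^ 2 ≤ δ ^ 2

/-- Bounded inner variation: `E ‖f'_{n,j}(x) - f_n'(x)‖² ≤ κ²`, with `j` uniform in the dataset of
`n`, for every honest client `n`. -/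
def BoundedInnerVariation (κ : ℝ) : Prop :=
  ∀ n ∉ F.byz, ∀ x : Param p,
    (∑ j : Fin (F.size n), ‖F.stochGrad n j x - gradient (F.localLoss n) x‖ ^ 2) / F.size n ≤ κ ^ 2

/-- One local SGD step of client `n` from the model `x`, using its sample `j`. -/
def sgdStep (η : ℝ) (n : Fin N) (j : Fin (F.size n)) (x : Param p) : Param p :=
  x - η • F.stochGrad n j x

/-- The model update of client `n` (its local model after one SGD step minus the global model). -/
def modelUpdate (η : ℝ) (n : Fin N) (j : Fin (F.size n)) (x : Param p) : Param p :=
  F.sgdStep η n j x - x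

end Federation

/-- The maps `a : ι → Fin G` all of whose fibres have exactly `k` elements, that is, the divisions
of `ι` into `G` labelled groups of size `k`. -/
def balanced (ι : Type*) [Fintype ι] (G k : ℕ) : Set (ι → Fin G) :=
  {a | ∀ g, (Finset.univ.filter fun i => a i = g).card = k}

/-- All the randomness of one global round:
* the group of each client,
* the resampling: `s` copies of each of the `G` group updates are distributed over `G` new messages;
  the copy `c` of the group update `g` goes into the new message number `resample (g, c)`,
* the index of the sample that each client uses in its SGD step,
* the channel noise of each time slot. -/
abbrev Seed (F : Federation p N Ξ) (G s : ℕ) : Type :=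
  (Fin N → Fin G) × (Fin G × Fin s → Fin G) × (∀ n, Fin (F.size n)) × (Fin G → Param p)

namespace Seed

variable {F : Federation p N Ξ} {G s : ℕ}

def group (ζ : Seed F G s) : Fin N → Fin G := ζ.1

def resample (ζ : Seed F G s) : Fin G × Fin s → Fin G := ζ.2.1

def sample (ζ : Seed F G s) (n : Fin N) : Fin (F.size n) := ζ.2.2.1 n

def noise (ζ : Seed F G s) : Fin G → Param p := ζ.2.2.2

end Seed

/-- The law of the randomness of one round: a uniform division of the clients into `G` groups of
size `m`, a uniform resampling in which every new message takes `s` of the `G * s` copies, uniform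
sample indices, and `N(0, σ² I_p)` noises, all of them independent. -/
def seedLaw (F : Federation p N Ξ) (G m s : ℕ) (σ : ℝ) : Measure (Seed F G s) :=
  (uniformOn (balanced (Fin N) G m)).prod <|
    (uniformOn (balanced (Fin G × Fin s) G s)).prod <|
      (Measure.pi fun n => uniformOn (Set.univ : Set (Fin (F.size n)))).prod <|
        Measure.pi fun _ : Fin G => multivariateGaussian 0 (σ ^ 2 • (1 : Matrix (Fin p) (Fin p) ℝ))

/-- `z` is a geometric median of the vectors `u i`: it minimizes the sum of the distances. -/
def IsGeomMedian {ι : Type*} [Fintype ι] (u : ι → Param p) (z : Param p) : Prop :=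
  IsMinOn (fun y => ∑ i, ‖y - u i‖) Set.univ z

/-- The `s`-resampling step: the new message `k` is the average of the `s` vectors that were drawn
for it. -/
def resampled {G s : ℕ} (c : Fin G × Fin s → Fin G) (u : Fin G → Param p) (k : Fin G) : Param p :=
  (1 / (s : ℝ)) • ∑ i ∈ Finset.univ.filter (fun i => c i = k), u i.1

section Round

variable (F : Federation p N Ξ) {G s : ℕ}

/-- What client `n` puts in the place of its model update: the model update itself if `n` is honest,
an arbitrary vector `attack n` if `n` is Byzantine. -/
def message (η : ℝ) (attack : Fin N → Param p) (x : Param p) (ζ : Seed F G s) (n : Fin N) :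
    Param p :=
  if n ∈ F.byz then attack n else F.modelUpdate η n (ζ.sample n) x

/-- The clients of group `g` that transmit: those whose channel magnitude exceeds `hmin`. -/
def transmitters (hmin : ℝ) (h : Fin N → ℝ) (ζ : Seed F G s) (g : Fin G) : Finset (Fin N) :=
  Finset.univ.filter fun n => ζ.group n = g ∧ hmin < h n

/-- The signal received in the time slot of group `g`. Channel inversion at the clients makes each
transmitting client contribute `ρ h_min` times its message. -/
def received (η ρ hmin : ℝ) (h : Fin N → ℝ) (attack : Fin N → Param p) (x : Param p)
    (ζ : Seed F G s) (g : Fin G) : Param p :=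
  ∑ n ∈ transmitters F hmin h ζ g, (ρ * hmin) • message F η attack x ζ n + ζ.noise g

/-- The update of group `g` as estimated by the server. -/
def groupUpdate (η ρ hmin : ℝ) (h : Fin N → ℝ) (attack : Fin N → Param p) (x : Param p)
    (ζ : Seed F G s) (g : Fin G) : Param p :=
  (1 / (ρ * hmin * ((transmitters F hmin h ζ g).card : ℝ))) •
    received F η ρ hmin h attack x ζ g

end Round

section Run

variable {Ω : Type*} [MeasurableSpace Ω] (Pr : Measure Ω) (F : Federation p N Ξ) {G s : ℕ}

/-- The power scaling factor `ρ_t = √(P / max_n E ‖m_t^n‖²)`, the maximum being over the honest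
clients. If the maximum is `0`, honest clients have nothing to send; then `ρ_t = 0`, and
`groupUpdate` is `0` as well, the honest update without noise. -/
def powerScale (η P : ℝ) (ζ : Ω → Seed F G s) (w : Ω → Param p) : ℝ :=
  √(P / ⨆ n : {n : Fin N // n ∉ F.byz}, ∫ ω, ‖F.modelUpdate η n ((ζ ω).sample n) (w ω)‖ ^ 2 ∂Pr)

/-- `w` is a run of the algorithm with `s`-resampling, with constant step size `η` and one local SGD
step per round. Here `𝔽 t` is what has happened before round `t`, `ζ t` is the randomness of round
`t`, `h t` are the channel magnitudes (all clients are able to transmit), and `attack t` are the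
vectors sent by the Byzantine clients. The attacks are arbitrary functions of `ω`, so they may depend
on the past, on each other and on all the randomness of the current round. -/
structure IsRun (G m s : ℕ) (η P hmin σ : ℝ) (w₀ : Param p) (𝔽 : Filtration ℕ ‹MeasurableSpace Ω›)
    (ζ : ℕ → Ω → Seed F G s) (h : ℕ → Ω → Fin N → ℝ) (attack : ℕ → Ω → Fin N → Param p)
    (w : ℕ → Ω → Param p) : Prop where
  init : ∀ ω, w 0 ω = w₀
  adapted : ∀ t, Measurable[𝔽 t] (w t)
  seed_law : ∀ t, HasLaw (ζ t) (seedLaw F G m s σ) Pr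
  seed_indep : ∀ t, Indep (MeasurableSpace.comap (ζ t) inferInstance) (𝔽 t) Pr
  channel : ∀ t ω n, hmin < h t ω n
  step : ∀ t, ∀ᵐ ω ∂Pr,
    IsGeomMedian
      (resampled (ζ t ω).resample
        (groupUpdate F η (powerScale Pr F η P (ζ t) (w t)) hmin (h t ω) (attack t ω) (w t ω) (ζ t ω)))
      (w (t + 1) ω - w t ω)

/-- Bounded stochastic gradients along the run: `E ‖f'_{n,j_n^t}(w_t)‖² ≤ K²` for every honest client
`n` and every round `t`. -/
def BoundedStochGrad (ζ : ℕ → Ω → Seed F G s) (w : ℕ → Ω → Param p) (K : ℝ) : Prop :=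
  ∀ n ∉ F.byz, ∀ t, ∫ ω, ‖F.stochGrad n ((ζ t ω).sample n) (w t ω)‖ ^ 2 ∂Pr ≤ K ^ 2

end Run

/-- `C_a = (2 - 2a) / (1 - 2a)`. -/
def medianConst (a : ℝ) : ℝ := (2 - 2 * a) / (1 - 2 * a)

/-- `d = (G - 1) / (s G - 1)`. -/
def resampleFactor (G s : ℝ) : ℝ := (G - 1) / (s * G - 1)

/-- The asymptotic error `A₂`. -/
def asymptoticError (p G m s B : ℕ) (μ δ κ K σ P hmin : ℝ) : ℝ :=
  2 / μ ^ 2 * medianConst (s * (B / G)) ^ 2 *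
    (resampleFactor G s + (1 - resampleFactor G s) / ((G : ℝ) - B)) *
    (δ ^ 2 + κ ^ 2 + p * σ ^ 2 / (m * P * hmin ^ 2) * K ^ 2)

end

end ROTAF

/-! Idea of the proof. One round is an inexact gradient step `w_{t+1} = w_t - η ∇f(w_t) + e_t`.
Strong convexity and the Lipschitz gradient make the exact step contract the squared distance to the
minimizer by `1 - 2ημ + η²L²`. Young's inequality with parameter `ημ/2` absorbs `e_t` at the price
`2/(ημ) ‖e_t‖²` and leaves the factor `1 - ημ` (`norm_perturbedStep_sub_sq_le`). It remains to bound
`E ‖e_t‖²`; the resulting affine recursion has fixed point `A₂`.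

Robustness is deterministic. At most `B` groups contain a Byzantine client, hence at most `sB < G/2`
resampled messages contain a copy of such a group. Comparing the median objective at its minimizer
and at `-η ∇f(w_t)` bounds `‖e_t‖²` by `C_{sα}²` times the mean squared error of the good messages
(`IsGeomMedian.norm_sub_sq_le`, `norm_geomMedian_sub_sq_le`). This majorant, `meanGoodError`,
involves only `w_t` and the seed, so the attacks disappear before any expectation is taken and may
depend on everything.

Its expectation is computed for a frozen model, from the inside out. Noises and sample indices are
centred and independent, so they contribute variances, and the deterministic client biases `f_n' -
f'` remain. Resampling replaces a mean of squares by `d` times itself plus `1 - d` times the square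
of the mean (`sum_resampling_le`); applied to an orthonormal basis, the same inequality controls the
squared weights multiplying the variances (`sum_resampling_bias_le`). Finally the biases of the
honest clients sum to zero, so the random division makes the square of their mean at most `η²δ²/(G -
B)` on average (`sum_grouping_le`).

Both combinatorial averages rest on exchangeability. The number of good messages and the number of
honest groups are random, but neither changes when two honest items or clients are swapped. The
averaged quadratic form therefore has only one diagonal and one off-diagonal coefficient
(`exists_eq_of_swap_invariant`), and these are determined or bounded through the trace and the row
sums. -/

namespace ROTAF

/-! ### Exchangeable kernels -/

/-- A kernel on a finite set that is invariant under all transpositions has only two values, one on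
the diagonal and one off the diagonal. -/
theorem exists_eq_of_swap_invariant {ι : Type*} [DecidableEq ι] (T : Finset ι) (W : ι → ι → ℝ)
    (hnn : ∀ i j, 0 ≤ W i j)
    (hW : ∀ a ∈ T, ∀ b ∈ T, ∀ i j, W (Equiv.swap a b i) (Equiv.swap a b j) = W i j) :
    ∃ α β : ℝ, 0 ≤ β ∧ ∀ i ∈ T, ∀ j ∈ T, W i j = if i = j then α else β := by
  have hdiag : ∀ i ∈ T, ∀ i' ∈ T, W i i = W i' i' := by
    intro i hi i' hi'
    have := hW i hi i' hi' i i
    simpa using this.symm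
  have hoff : ∀ i ∈ T, ∀ j ∈ T, ∀ i' ∈ T, ∀ j' ∈ T, i ≠ j → i' ≠ j' → W i j = W i' j' := by
    intro i hi j hj i' hi' j' hj' hij hij'
    have h1 := hW i hi i' hi' i j
    rw [Equiv.swap_apply_left] at h1
    -- The first swap takes `i` to `i'` and `j` to some point of `T` other than `i'`; a second swap
    -- takes that point to `j'` and fixes `i'`.
    have hmem : Equiv.swap i i' j ∈ T := by
      rw [Equiv.swap_apply_def]; split_ifs <;> assumption
    have hne : Equiv.swap i i' j ≠ i' := by
      intro h
      have : Equiv.swap i i' j = Equiv.swap i i' i := by rw [h, Equiv.swap_apply_left]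
      exact hij ((Equiv.swap i i').injective this).symm
    have h2 := hW _ hmem j' hj' i' (Equiv.swap i i' j)
    rw [Equiv.swap_apply_left, Equiv.swap_apply_of_ne_of_ne hne.symm hij'] at h2
    rw [← h1, h2]
  by_cases hT : ∃ i ∈ T, ∃ j ∈ T, i ≠ j
  · obtain ⟨i, hi, j, hj, hij⟩ := hT
    refine ⟨W i i, W i j, hnn _ _, fun a ha b hb => ?_⟩
    split_ifs with h
    · rw [← h]; exact hdiag _ ha _ hi
    · exact hoff _ ha _ hb _ hi _ hj h hij
  -- With at most one point there is no off-diagonal pair, and the value `0` keeps `β` non-negative.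
  · push Not at hT
    by_cases hne : T.Nonempty
    · obtain ⟨i, hi⟩ := hne
      refine ⟨W i i, 0, le_rfl, fun a ha b hb => ?_⟩
      rw [← hT i hi a ha, ← hT i hi b hb, if_pos rfl]
    · exact ⟨0, 0, le_rfl, fun a ha => absurd ⟨a, ha⟩ hne⟩

/-! ### Quadratic forms with a two-valued kernel -/

section Quadratic

variable {E : Type*} [NormedAddCommGroup E] [InnerProductSpace ℝ E]

theorem norm_sum_sq {ι : Type*} (T : Finset ι) (e : ι → E) :
    ‖∑ i ∈ T, e i‖ ^ 2 = ∑ i ∈ T, ∑ j ∈ T, ⟪e i, e j⟫_ℝ := by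
  rw [← real_inner_self_eq_norm_sq, sum_inner]
  simp_rw [inner_sum]

theorem sum_kernel_mul_inner {ι : Type*} [DecidableEq ι] (T : Finset ι) (α β : ℝ) (e : ι → E) :
    ∑ i ∈ T, ∑ j ∈ T, (if i = j then α else β) * ⟪e i, e j⟫_ℝ
      = (α - β) * ∑ i ∈ T, ‖e i‖ ^ 2 + β * ‖∑ i ∈ T, e i‖ ^ 2 := by
  rw [norm_sum_sq, Finset.mul_sum, Finset.mul_sum, ← Finset.sum_add_distrib]
  refine Finset.sum_congr rfl fun i hi => ?_
  have h : ∀ j ∈ T, (if i = j then α else β) * ⟪e i, e j⟫_ℝ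
      = (if i = j then (α - β) * ⟪e i, e j⟫_ℝ else 0) + β * ⟪e i, e j⟫_ℝ := by
    intro j _
    split_ifs <;> ring
  rw [Finset.sum_congr rfl h, Finset.sum_add_distrib, Finset.sum_ite_eq, if_pos hi,
    real_inner_self_eq_norm_sq, Finset.mul_sum]

theorem norm_average_sq_le {ι : Type*} (T : Finset ι) (e : ι → E) :
    ‖(1 / (T.card : ℝ)) • ∑ i ∈ T, e i‖ ^ 2 ≤ (1 / (T.card : ℝ)) * ∑ i ∈ T, ‖e i‖ ^ 2 := by
  rcases T.eq_empty_or_nonempty with rfl | hT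
  · simp
  have hc : (0 : ℝ) < T.card := by exact_mod_cast hT.card_pos
  have h1 : ‖∑ i ∈ T, e i‖ ^ 2 ≤ (∑ i ∈ T, ‖e i‖) ^ 2 := by
    gcongr; exact norm_sum_le _ _
  have h2 := sq_sum_le_card_mul_sum_sq (s := T) (f := fun i => ‖e i‖)
  rw [norm_smul, mul_pow, Real.norm_eq_abs, sq_abs]
  calc (1 / (T.card : ℝ)) ^ 2 * ‖∑ i ∈ T, e i‖ ^ 2
      ≤ (1 / (T.card : ℝ)) ^ 2 * (T.card * ∑ i ∈ T, ‖e i‖ ^ 2) := by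
        gcongr; exact h1.trans h2
    _ = _ := by field_simp

end Quadratic

/-! ### Balanced maps -/

open Classical in
/-- The finite set of balanced maps. -/
noncomputable def balancedFinset (ι : Type*) [Fintype ι] (G k : ℕ) : Finset (ι → Fin G) :=
  Finset.univ.filter (· ∈ balanced ι G k)

theorem mem_balancedFinset {ι : Type*} [Fintype ι] {G k : ℕ} {a : ι → Fin G} :
    a ∈ balancedFinset ι G k ↔ a ∈ balanced ι G k := by
  simp [balancedFinset]

theorem coe_balancedFinset (ι : Type*) [Fintype ι] (G k : ℕ) :
    (balancedFinset ι G k : Set (ι → Fin G)) = balanced ι G k := by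
  ext; simp [balancedFinset]

theorem comp_mem_balanced {ι : Type*} [Fintype ι] {G k : ℕ} {a : ι → Fin G}
    (ha : a ∈ balanced ι G k) (π : Equiv.Perm ι) : a ∘ π ∈ balanced ι G k := by
  intro g
  rw [← ha g]
  refine Finset.card_equiv π fun i => ?_
  simp

/-- Precomposition with an involution is a self-inverse bijection of the balanced maps. Used with
transpositions, this is the exchangeability of uniform divisions and resamplings. -/
theorem sum_balanced_comp_perm {ι : Type*} [Fintype ι] {G k : ℕ} (π : Equiv.Perm ι)
    (hπ : ∀ i, π (π i) = i) (f : (ι → Fin G) → ℝ) :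
    ∑ a ∈ balancedFinset ι G k, f (a ∘ π) = ∑ a ∈ balancedFinset ι G k, f a := by
  refine Finset.sum_nbij' (fun a => a ∘ π) (fun a => a ∘ π) ?_ ?_ ?_ ?_ ?_
  · intro a ha
    exact mem_balancedFinset.2 (comp_mem_balanced (mem_balancedFinset.1 ha) π)
  · intro a ha
    exact mem_balancedFinset.2 (comp_mem_balanced (mem_balancedFinset.1 ha) π)
  · intro a _; ext i; simp [hπ]
  · intro a _; ext i; simp [hπ]
  · intro a _; rfl

/-- Guarantees that the uniform law on balanced maps is a probability measure and that its
normalizing constant is non-zero. -/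
theorem balanced_nonempty {ι : Type*} [Fintype ι] {G k : ℕ} (h : Fintype.card ι = G * k) :
    (balanced ι G k).Nonempty := by
  have e : ι ≃ Fin G × Fin k := Fintype.equivOfCardEq (by simp [h])
  refine ⟨fun i => (e i).1, fun g => ?_⟩
  have : (Finset.univ.filter fun i => (e i).1 = g).card
      = (Finset.univ.filter fun x : Fin G × Fin k => x.1 = g).card := by
    refine Finset.card_equiv e fun i => ?_
    simp
  rw [this]
  have h2 : (Finset.univ.filter fun x : Fin G × Fin k => x.1 = g)
      = ({g} : Finset (Fin G)) ×ˢ Finset.univ := by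
    ext x
    simp only [Finset.mem_filter, Finset.mem_univ, true_and, Finset.mem_product,
      Finset.mem_singleton, and_true]
  rw [h2]; simp

/-! ### Good messages and resampling weights -/

section Resampling

variable {G s : ℕ}

/-- The new messages all of whose constituents come from `H`. -/
def goodMessages (H : Finset (Fin G)) (c : Fin G × Fin s → Fin G) : Finset (Fin G) :=
  Finset.univ.filter fun k => ∀ i, c i = k → i.1 ∈ H

/-- The weight of the group update `g` in the new message `k`. -/
noncomputable def resampleWeight (c : Fin G × Fin s → Fin G) (k g : Fin G) : ℝ :=
  ((Finset.univ.filter fun i : Fin G × Fin s => c i = k ∧ i.1 = g).card : ℝ) / s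

theorem sum_resampleWeight_smul {E : Type*} [AddCommGroup E] [Module ℝ E]
    (c : Fin G × Fin s → Fin G) (k : Fin G) (e : Fin G → E) :
    ∑ g, resampleWeight c k g • e g
      = (1 / (s : ℝ)) • ∑ i ∈ Finset.univ.filter (fun i => c i = k), e i.1 := by
  rw [← Finset.sum_fiberwise (Finset.univ.filter (fun i => c i = k)) (fun i => i.1)
    (fun i => e i.1), Finset.smul_sum]
  refine Finset.sum_congr rfl fun g _ => ?_
  rw [Finset.filter_filter]
  have : ∑ i ∈ Finset.univ.filter (fun i : Fin G × Fin s => c i = k ∧ i.1 = g), e i.1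
      = ∑ i ∈ Finset.univ.filter (fun i : Fin G × Fin s => c i = k ∧ i.1 = g), e g := by
    refine Finset.sum_congr rfl fun i hi => ?_
    rw [(Finset.mem_filter.1 hi).2.2]
  rw [this, Finset.sum_const, resampleWeight, ← Nat.cast_smul_eq_nsmul ℝ, smul_smul]
  congr 1
  ring

theorem sum_resampleWeight (hs : 0 < s) {c : Fin G × Fin s → Fin G}
    (hc : c ∈ balanced (Fin G × Fin s) G s) (k : Fin G) : ∑ g, resampleWeight c k g = 1 := by
  have := sum_resampleWeight_smul c k (fun _ => (1 : ℝ))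
  simp only [smul_eq_mul, mul_one, Finset.sum_const, hc k, nsmul_eq_mul] at this
  rw [this]
  field_simp

theorem resampleWeight_eq_zero {H : Finset (Fin G)} {c : Fin G × Fin s → Fin G} {k g : Fin G}
    (hk : k ∈ goodMessages H c) (hg : g ∉ H) : resampleWeight c k g = 0 := by
  have : (Finset.univ.filter fun i : Fin G × Fin s => c i = k ∧ i.1 = g) = ∅ := by
    refine Finset.filter_eq_empty_iff.2 fun i _ h => hg ?_
    rw [← h.2]
    exact (Finset.mem_filter.1 hk).2 i h.1
  simp [resampleWeight, this]

/-- Each bad message receives at least one of the `s` copies of some group outside `H`, and each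
copy goes to a single message. -/
theorem card_compl_goodMessages_le (H : Finset (Fin G)) (c : Fin G × Fin s → Fin G) :
    (goodMessages H c)ᶜ.card ≤ s * Hᶜ.card := by
  classical
  have hsub : (goodMessages H c)ᶜ ⊆ (Hᶜ ×ˢ (Finset.univ : Finset (Fin s))).image c := by
    intro k hk
    simp only [goodMessages, Finset.mem_compl, Finset.mem_filter, Finset.mem_univ, true_and,
      not_forall] at hk
    obtain ⟨i, hik, hi⟩ := hk
    exact Finset.mem_image.2 ⟨i, by simp [hi], hik⟩
  calc _ ≤ _ := Finset.card_le_card hsub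
    _ ≤ _ := Finset.card_image_le
    _ = _ := by simp [mul_comm]

/-- Being good depends only on which items come from `H`, and exchanging two such items does not
affect this. -/
theorem goodMessages_comp_swap (H : Finset (Fin G)) (c : Fin G × Fin s → Fin G)
    {a b : Fin G × Fin s} (ha : a.1 ∈ H) (hb : b.1 ∈ H) :
    goodMessages H (c ∘ Equiv.swap a b) = goodMessages H c := by
  have hmem : ∀ i, (Equiv.swap a b i).1 ∈ H ↔ i.1 ∈ H := by
    intro i
    rw [Equiv.swap_apply_def]
    split_ifs with h1 h2
    · subst h1; simp [ha, hb]
    · subst h2; simp [ha, hb]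
    · rfl
  ext k
  simp only [goodMessages, Finset.mem_filter, Finset.mem_univ, true_and, Function.comp]
  constructor
  · intro h i hi
    have := h (Equiv.swap a b i) (by simpa using hi)
    exact (hmem i).1 this
  · intro h i hi
    exact (hmem i).1 (h _ hi)

/-- For `G = s = 1` the quotient `0 / 0` is `0`, so this bound and the next persist, and the factor
`d + (1 - d) / (G - B)` with `B = 0` is `1`, as it should be. -/
theorem resampleFactor_nonneg (hs : 0 < s) : 0 ≤ resampleFactor G s := by
  rcases Nat.eq_zero_or_pos G with rfl | hG
  · norm_num [resampleFactor]
  have hG' : (1 : ℝ) ≤ G := by exact_mod_cast hG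
  have hs' : (1 : ℝ) ≤ s := by exact_mod_cast hs
  exact div_nonneg (by linarith) (by nlinarith)

theorem resampleFactor_le_one (hG : 0 < G) (hs : 0 < s) : resampleFactor G s ≤ 1 := by
  have hG' : (1 : ℝ) ≤ G := by exact_mod_cast hG
  have hs' : (1 : ℝ) ≤ s := by exact_mod_cast hs
  exact div_le_one_of_le₀ (by nlinarith) (by nlinarith)

end Resampling

/-! ### Mean squared norm of the good messages under uniform resampling -/

section Resampling

variable {G s : ℕ} {E : Type*} [NormedAddCommGroup E] [InnerProductSpace ℝ E]

/-- The indicator of the event that the items `i` and `j` belong to the same good message. -/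
noncomputable def sameGood (H : Finset (Fin G)) (c : Fin G × Fin s → Fin G)
    (i j : Fin G × Fin s) : ℝ :=
  if c i = c j ∧ c i ∈ goodMessages H c then 1 else 0

theorem mem_of_mem_goodMessages {H : Finset (Fin G)} {c : Fin G × Fin s → Fin G}
    {i : Fin G × Fin s} (hi : c i ∈ goodMessages H c) : i ∈ H ×ˢ (Finset.univ : Finset (Fin s)) := by
  rw [Finset.mem_product]
  exact ⟨(Finset.mem_filter.1 hi).2 i rfl, Finset.mem_univ _⟩

/-- Expanding the squares turns the sum over good messages into a quadratic form in the items of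
`H`, with kernel `sameGood`, to which exchangeability applies. -/
theorem sum_good_norm_sq (H : Finset (Fin G)) (c : Fin G × Fin s → Fin G) (e : Fin G → E) :
    ∑ k ∈ goodMessages H c, ‖∑ g, resampleWeight c k g • e g‖ ^ 2
      = (1 / (s : ℝ)) ^ 2 * ∑ i ∈ H ×ˢ Finset.univ, ∑ j ∈ H ×ˢ Finset.univ,
          sameGood H c i j * ⟪e i.1, e j.1⟫_ℝ := by
  have h1 : ∀ k ∈ goodMessages H c, ‖∑ g, resampleWeight c k g • e g‖ ^ 2
      = (1 / (s : ℝ)) ^ 2 * ∑ i ∈ H ×ˢ Finset.univ, ∑ j ∈ H ×ˢ Finset.univ,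
          (if c i = k ∧ c j = k then ⟪e i.1, e j.1⟫_ℝ else 0) := by
    intro k hk
    have hfil : Finset.univ.filter (fun i => c i = k)
        = (H ×ˢ Finset.univ).filter (fun i => c i = k) := by
      ext i
      simp only [Finset.mem_filter, Finset.mem_univ, true_and]
      refine ⟨fun h => ⟨mem_of_mem_goodMessages (c := c) (h ▸ hk), h⟩, fun h => h.2⟩
    rw [sum_resampleWeight_smul, norm_smul, mul_pow, Real.norm_eq_abs, sq_abs, hfil,
      Finset.sum_filter, norm_sum_sq]
    congr 1
    refine Finset.sum_congr rfl fun i _ => Finset.sum_congr rfl fun j _ => ?_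
    by_cases hi : c i = k <;> by_cases hj : c j = k <;> simp [hi, hj]
  rw [Finset.sum_congr rfl h1, ← Finset.mul_sum, Finset.sum_comm]
  congr 1
  refine Finset.sum_congr rfl fun i _ => ?_
  rw [Finset.sum_comm]
  refine Finset.sum_congr rfl fun j _ => ?_
  by_cases hij : c i = c j
  · by_cases hg : c i ∈ goodMessages H c
    · simp only [sameGood, hij, true_and]
      rw [hij] at hg
      simp [hg]
    · simp only [sameGood, hij, true_and]
      rw [hij] at hg
      simp [hg]
  · have : ∀ k ∈ goodMessages H c, (if c i = k ∧ c j = k then ⟪e i.1, e j.1⟫_ℝ else 0) = 0 := by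
      intro k _
      rw [if_neg]
      rintro ⟨h, h'⟩
      exact hij (h.trans h'.symm)
    rw [Finset.sum_eq_zero this]
    simp [sameGood, hij]

theorem sum_sameGood_self {H : Finset (Fin G)} {c : Fin G × Fin s → Fin G}
    (hc : c ∈ balanced (Fin G × Fin s) G s) :
    ∑ i ∈ H ×ˢ Finset.univ, sameGood H c i i = s * ((goodMessages H c).card : ℝ) := by
  have h1 : ∑ i ∈ H ×ˢ Finset.univ, sameGood H c i i = ∑ i, sameGood H c i i := by
    refine Finset.sum_subset (Finset.subset_univ _) fun i _ hi => ?_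
    simp only [sameGood, true_and]
    exact if_neg fun h => hi (mem_of_mem_goodMessages h)
  rw [h1, ← Finset.sum_fiberwise Finset.univ c]
  have h2 : ∀ k, ∑ i ∈ Finset.univ.filter (fun i => c i = k), sameGood H c i i
      = if k ∈ goodMessages H c then (s : ℝ) else 0 := by
    intro k
    have : ∑ i ∈ Finset.univ.filter (fun i => c i = k), sameGood H c i i
        = ∑ i ∈ Finset.univ.filter (fun i => c i = k), if k ∈ goodMessages H c then (1 : ℝ) else 0 := by
      refine Finset.sum_congr rfl fun i hi => ?_
      simp [sameGood, (Finset.mem_filter.1 hi).2]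
    rw [this, Finset.sum_const, hc k]
    simp
  simp_rw [h2]
  simp [mul_comm]

/-- A good message consists of exactly `s` items, all of them over `H`, so restricting the sum to
those items loses nothing. This fixes the row sums of the averaged kernel. -/
theorem sum_sameGood {H : Finset (Fin G)} {c : Fin G × Fin s → Fin G}
    (hc : c ∈ balanced (Fin G × Fin s) G s) (i : Fin G × Fin s) :
    ∑ j ∈ H ×ˢ Finset.univ, sameGood H c i j = s * sameGood H c i i := by
  by_cases hg : c i ∈ goodMessages H c
  · have h1 : ∑ j ∈ H ×ˢ Finset.univ, sameGood H c i j = ∑ j, sameGood H c i j := by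
      refine Finset.sum_subset (Finset.subset_univ _) fun j _ hj => ?_
      refine if_neg fun h => hj (mem_of_mem_goodMessages (c := c) ?_)
      rw [← h.1]; exact h.2
    rw [h1]
    simp only [sameGood, hg, and_true, if_true, mul_one]
    have h2 := hc (c i)
    rw [Finset.card_filter] at h2
    simp_rw [eq_comm (a := c i)]
    exact_mod_cast h2
  · simp [sameGood, hg]

theorem sameGood_comp_swap (H : Finset (Fin G)) (c : Fin G × Fin s → Fin G)
    {a b : Fin G × Fin s} (ha : a.1 ∈ H) (hb : b.1 ∈ H) (i j : Fin G × Fin s) :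
    sameGood H (c ∘ Equiv.swap a b) i j = sameGood H c (Equiv.swap a b i) (Equiv.swap a b j) := by
  simp [sameGood, goodMessages_comp_swap H c ha hb]

/-- The exact factor for `h` honest groups increases with `h`; after cross-multiplication the gap is
`(G - h)(s - 1)`. This replaces the random number of honest groups by `G`. -/
theorem sub_one_div_le {h G s : ℝ} (hG : h ≤ G) (hs : 1 ≤ s) (hhs : 1 < h * s) :
    (h - 1) / (h * s - 1) ≤ resampleFactor G s := by
  have h1 : 0 < h * s - 1 := by linarith
  have h2 : 0 < s * G - 1 := by nlinarith
  rw [resampleFactor, div_le_div_iff₀ h1 h2]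
  nlinarith [mul_nonneg (sub_nonneg.2 hG) (sub_nonneg.2 hs)]

/-- With `A` the mean of the squares and `B` the square of the mean, trace and row sum determine `α`
and `β`, and the form equals `M (d_h A + (1 - d_h) B)` with `d_h = (h - 1) / (h s - 1)`. Since `B ≤
A`, enlarging `d_h` to `d` only increases it. -/
theorem two_value_kernel_le {α β s h G M x y : ℝ} (hs : 1 ≤ s) (hh : 1 ≤ h) (hG : h ≤ G)
    (hα : h * α = M) (hβ : α + (h * s - 1) * β = s * α)
    (hxy : (1 / h) ^ 2 * y ≤ 1 / h * x) (hxy' : h = 1 → x = y) (hM : 0 ≤ M := by positivity) :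
    (1 / s) ^ 2 * ((α - β) * (s * x) + β * (s ^ 2 * y))
      ≤ M * (resampleFactor G s * (1 / h * x) + (1 - resampleFactor G s) * ((1 / h) ^ 2 * y)) := by
  have hh0 : 0 < h := by linarith
  have hs0 : 0 < s := by linarith
  obtain ⟨A, rfl⟩ : ∃ A, x = h * A := ⟨x / h, by field_simp⟩
  obtain ⟨B, rfl⟩ : ∃ B, y = h ^ 2 * B := ⟨y / h ^ 2, by field_simp⟩
  have hA : 1 / h * (h * A) = A := by field_simp
  have hB : (1 / h) ^ 2 * (h ^ 2 * B) = B := by field_simp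
  rw [hA, hB] at hxy ⊢
  have hlhs : (1 / s) ^ 2 * ((α - β) * (s * (h * A)) + β * (s ^ 2 * (h ^ 2 * B)))
      = M * B + (M - h * β) / s * (A - B) := by
    rw [← hα]
    field_simp
    linear_combination B * hβ
  rw [hlhs]
  by_cases hhs : 1 < h * s
  · have hβ' : (M - h * β) / s = M * ((h - 1) / (h * s - 1)) := by
      have h0 : h * s - 1 ≠ 0 := by linarith
      rw [← hα]
      field_simp
      linear_combination (-1) * hβ
    rw [hβ']
    have h3 : M * ((h - 1) / (h * s - 1)) * (A - B) ≤ M * resampleFactor G s * (A - B) := by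
      have : 0 ≤ A - B := by linarith
      have hd := sub_one_div_le hG hs hhs
      gcongr
    linarith
  -- Here `h = s = 1` and `d_h` would be `0 / 0`; with a single vector `A = B`, so the value of `d`
  -- is irrelevant.
  · have hh1 : h = 1 := by nlinarith
    have := hxy' hh1
    rw [hh1] at this
    have hAB : A = B := by linarith
    rw [hAB]
    apply le_of_eq
    ring

/-- The effect of a uniform resampling on the mean squared norm of the good messages: up to the
factor `resampleFactor G s` it replaces the mean of the squares by the square of the mean. -/
theorem sum_resampling_le (hs : 0 < s) {H : Finset (Fin G)} (hH : H.Nonempty)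
    (hgood : ∀ c : Fin G × Fin s → Fin G, (goodMessages H c).Nonempty) (e : Fin G → E) :
    ∑ c ∈ balancedFinset (Fin G × Fin s) G s, (1 / ((goodMessages H c).card : ℝ)) *
        ∑ k ∈ goodMessages H c, ‖∑ g, resampleWeight c k g • e g‖ ^ 2
      ≤ (balancedFinset (Fin G × Fin s) G s).card *
        (resampleFactor G s * ((1 / (H.card : ℝ)) * ∑ g ∈ H, ‖e g‖ ^ 2)
          + (1 - resampleFactor G s) * ‖(1 / (H.card : ℝ)) • ∑ g ∈ H, e g‖ ^ 2) := by
  classical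
  set C := balancedFinset (Fin G × Fin s) G s with hC
  set T : Finset (Fin G × Fin s) := H ×ˢ Finset.univ with hT
  set W : Fin G × Fin s → Fin G × Fin s → ℝ := fun i j =>
    ∑ c ∈ C, (1 / ((goodMessages H c).card : ℝ)) * sameGood H c i j with hWdef
  have hs0 : (0 : ℝ) < s := by exact_mod_cast hs
  have hs1 : (1 : ℝ) ≤ s := by exact_mod_cast hs
  have hh1 : (1 : ℝ) ≤ H.card := by exact_mod_cast hH.card_pos
  have hhG : (H.card : ℝ) ≤ G := by
    have := Finset.card_le_univ H
    rw [Fintype.card_fin] at this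
    exact_mod_cast this
  have hTmem : ∀ i ∈ T, i.1 ∈ H := fun i hi => (Finset.mem_product.1 hi).1
  obtain ⟨α, β, -, hαβ⟩ := exists_eq_of_swap_invariant T W
    (fun i j => Finset.sum_nonneg fun c _ => mul_nonneg (by positivity)
      (by unfold sameGood; split_ifs <;> norm_num))
    (by
      intro a ha b hb i j
      rw [hWdef]
      simp only
      rw [← sum_balanced_comp_perm (Equiv.swap a b) (by simp)
        (fun c => (1 / ((goodMessages H c).card : ℝ)) * sameGood H c i j)]
      refine Finset.sum_congr rfl fun c _ => ?_
      rw [sameGood_comp_swap H c (hTmem a ha) (hTmem b hb),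
        goodMessages_comp_swap H c (hTmem a ha) (hTmem b hb)])
  have hTcard : (T.card : ℝ) = H.card * s := by simp [hT]
  -- Trace: because of the normalization by the number of good messages, every resampling
  -- contributes exactly `s`, however many good messages it has.
  have hα : H.card * α = C.card := by
    have h1 : ∑ i ∈ T, W i i = T.card * α := by
      rw [Finset.sum_congr rfl fun i hi => by rw [hαβ i hi i hi, if_pos rfl], Finset.sum_const,
        nsmul_eq_mul]
    have h2 : ∑ i ∈ T, W i i = s * C.card := by
      rw [hWdef]
      simp only
      rw [Finset.sum_comm]
      have : ∀ c ∈ C, ∑ i ∈ T, (1 / ((goodMessages H c).card : ℝ)) * sameGood H c i i = s := by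
        intro c hc
        have hpos : (0 : ℝ) < (goodMessages H c).card := by exact_mod_cast (hgood c).card_pos
        rw [← Finset.mul_sum, sum_sameGood_self (mem_balancedFinset.1 hc)]
        field_simp
      rw [Finset.sum_congr rfl this, Finset.sum_const, nsmul_eq_mul, mul_comm]
    rw [h1, hTcard] at h2
    have : s * (H.card * α) = s * C.card := by linarith
    exact mul_left_cancel₀ hs0.ne' this
  -- Row sum: an item in a good message shares it with `s` items, itself included.
  have hβ : α + (H.card * s - 1) * β = s * α := by
    obtain ⟨g, hg⟩ := hH
    have hi : ((g, ⟨0, hs⟩) : Fin G × Fin s) ∈ T := by simp [hT, hg]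
    set i : Fin G × Fin s := (g, ⟨0, hs⟩)
    have h1 : ∑ j ∈ T, W i j = s * W i i := by
      rw [hWdef]
      simp only
      rw [Finset.sum_comm, Finset.mul_sum]
      refine Finset.sum_congr rfl fun c hc => ?_
      rw [← Finset.mul_sum, sum_sameGood (mem_balancedFinset.1 hc)]
      ring
    have h2 : ∑ j ∈ T, W i j = α + (T.card - 1) * β := by
      have : ∀ j ∈ T, W i j = (if i = j then α - β else 0) + β := by
        intro j hj
        rw [hαβ i hi j hj]; split_ifs <;> ring
      rw [Finset.sum_congr rfl this, Finset.sum_add_distrib, Finset.sum_ite_eq, if_pos hi,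
        Finset.sum_const, nsmul_eq_mul]
      ring
    rw [h2, hαβ i hi i hi, if_pos rfl, hTcard] at h1
    exact h1
  have hsum : ∑ c ∈ C, (1 / ((goodMessages H c).card : ℝ)) *
        ∑ k ∈ goodMessages H c, ‖∑ g, resampleWeight c k g • e g‖ ^ 2
      = (1 / (s : ℝ)) ^ 2 * ∑ i ∈ T, ∑ j ∈ T, W i j * ⟪e i.1, e j.1⟫_ℝ := by
    have h1 : ∀ c ∈ C, (1 / ((goodMessages H c).card : ℝ)) *
        ∑ k ∈ goodMessages H c, ‖∑ g, resampleWeight c k g • e g‖ ^ 2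
        = (1 / (s : ℝ)) ^ 2 * ∑ i ∈ T, ∑ j ∈ T,
          (1 / ((goodMessages H c).card : ℝ)) * sameGood H c i j * ⟪e i.1, e j.1⟫_ℝ := by
      intro c _
      rw [sum_good_norm_sq, mul_left_comm, Finset.mul_sum]
      simp_rw [Finset.mul_sum, mul_assoc]
      rfl
    rw [Finset.sum_congr rfl h1, ← Finset.mul_sum, Finset.sum_comm]
    congr 1
    refine Finset.sum_congr rfl fun i _ => ?_
    rw [Finset.sum_comm]
    refine Finset.sum_congr rfl fun j _ => ?_
    rw [hWdef, Finset.sum_mul]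
  have hW2 : ∑ i ∈ T, ∑ j ∈ T, W i j * ⟪e i.1, e j.1⟫_ℝ
      = (α - β) * (s * ∑ g ∈ H, ‖e g‖ ^ 2) + β * (s ^ 2 * ‖∑ g ∈ H, e g‖ ^ 2) := by
    have h1 : ∑ i ∈ T, ∑ j ∈ T, W i j * ⟪e i.1, e j.1⟫_ℝ
        = ∑ i ∈ T, ∑ j ∈ T, (if i = j then α else β) * ⟪e i.1, e j.1⟫_ℝ :=
      Finset.sum_congr rfl fun i hi => Finset.sum_congr rfl fun j hj => by rw [hαβ i hi j hj]
    rw [h1, sum_kernel_mul_inner T α β (fun i => e i.1), hT, Finset.sum_product, Finset.sum_product]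
    simp only [Finset.sum_const, Finset.card_univ, Fintype.card_fin, ← Finset.smul_sum]
    rw [nsmul_eq_mul, ← Nat.cast_smul_eq_nsmul ℝ, norm_smul, mul_pow, Real.norm_eq_abs, sq_abs]
  rw [hsum, hW2]
  have hAB := norm_average_sq_le H e
  rw [norm_smul, mul_pow, Real.norm_eq_abs, sq_abs] at hAB ⊢
  refine two_value_kernel_le hs1 hh1 hhG hα hβ hAB fun hh => ?_
  obtain ⟨g, hg⟩ := Finset.card_eq_one.1 (Nat.cast_eq_one.1 hh)
  simp [hg]

end Resampling

/-! ### Averaging the client biases over a uniform division -/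

section Grouping

variable {N G m : ℕ} {E : Type*} [NormedAddCommGroup E] [InnerProductSpace ℝ E]

/-- The groups without Byzantine clients. -/
def honestGroups (byz : Finset (Fin N)) (a : Fin N → Fin G) : Finset (Fin G) :=
  (byz.image a)ᶜ

theorem not_mem_of_mem_honestGroups {byz : Finset (Fin N)} {a : Fin N → Fin G} {n : Fin N}
    (h : a n ∈ honestGroups byz a) : n ∉ byz := fun hn =>
  Finset.mem_compl.1 h (Finset.mem_image_of_mem a hn)

theorem card_compl_honestGroups_le (byz : Finset (Fin N)) (a : Fin N → Fin G) :
    (honestGroups byz a)ᶜ.card ≤ byz.card := by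
  rw [honestGroups, compl_compl]
  exact Finset.card_image_le

theorem sub_card_le_card_honestGroups (byz : Finset (Fin N)) (a : Fin N → Fin G) :
    (G : ℝ) - byz.card ≤ (honestGroups byz a).card := by
  have h1 := Finset.card_add_card_compl (honestGroups byz a)
  have h2 := card_compl_honestGroups_le byz a
  rw [Fintype.card_fin] at h1
  have h3 : G ≤ byz.card + (honestGroups byz a).card := by omega
  have h4 : (G : ℝ) ≤ byz.card + (honestGroups byz a).card := by exact_mod_cast h3
  linarith

/-- Swapping two honest clients does not move any Byzantine one, and only the positions of the
latter decide which groups are honest. -/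
theorem honestGroups_comp_swap (byz : Finset (Fin N)) (a : Fin N → Fin G) {i j : Fin N}
    (hi : i ∉ byz) (hj : j ∉ byz) :
    honestGroups byz (a ∘ Equiv.swap i j) = honestGroups byz a := by
  unfold honestGroups
  congr 1
  refine Finset.image_congr fun n hn => ?_
  have hni : n ≠ i := fun h => hi (h ▸ hn)
  have hnj : n ≠ j := fun h => hj (h ▸ hn)
  simp [Equiv.swap_apply_of_ne_of_ne hni hnj]

theorem sum_honest_indicator (byz : Finset (Fin N)) {a : Fin N → Fin G}
    (ha : a ∈ balanced (Fin N) G m) :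
    ∑ n ∈ byzᶜ, (if a n ∈ honestGroups byz a then (1 : ℝ) else 0)
      = (honestGroups byz a).card * m := by
  have h1 : ∑ n ∈ byzᶜ, (if a n ∈ honestGroups byz a then (1 : ℝ) else 0)
      = ∑ n, (if a n ∈ honestGroups byz a then (1 : ℝ) else 0) := by
    refine Finset.sum_subset (Finset.subset_univ _) fun n _ hn => if_neg fun h => ?_
    exact hn (Finset.mem_compl.2 (not_mem_of_mem_honestGroups h))
  rw [h1, ← Finset.sum_fiberwise Finset.univ a]
  have h2 : ∀ g, ∑ n ∈ Finset.univ.filter (fun n => a n = g),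
      (if a n ∈ honestGroups byz a then (1 : ℝ) else 0)
      = if g ∈ honestGroups byz a then (m : ℝ) else 0 := by
    intro g
    have : ∑ n ∈ Finset.univ.filter (fun n => a n = g),
        (if a n ∈ honestGroups byz a then (1 : ℝ) else 0)
        = ∑ n ∈ Finset.univ.filter (fun n => a n = g),
          if g ∈ honestGroups byz a then (1 : ℝ) else 0 := by
      refine Finset.sum_congr rfl fun n hn => ?_
      rw [(Finset.mem_filter.1 hn).2]
    rw [this, Finset.sum_const, ha g]
    simp
  simp_rw [h2]
  simp

theorem sum_honestGroups_sum {E : Type*} [AddCommMonoid E] (byz : Finset (Fin N)) (a : Fin N → Fin G) (b : Fin N → E) :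
    ∑ g ∈ honestGroups byz a, ∑ n ∈ Finset.univ.filter (fun n => a n = g), b n
      = ∑ n ∈ byzᶜ, if a n ∈ honestGroups byz a then b n else 0 := by
  have h1 : ∑ n ∈ byzᶜ, (if a n ∈ honestGroups byz a then b n else 0)
      = ∑ n, (if a n ∈ honestGroups byz a then b n else 0) := by
    refine Finset.sum_subset (Finset.subset_univ _) fun n _ hn => if_neg fun h => ?_
    exact hn (Finset.mem_compl.2 (not_mem_of_mem_honestGroups h))
  rw [h1, ← Finset.sum_filter, ← Finset.sum_fiberwise_of_maps_to (t := honestGroups byz a) (g := a)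
    (fun n hn => (Finset.mem_filter.1 hn).2)]
  refine Finset.sum_congr rfl fun g hg => Finset.sum_congr ?_ fun _ _ => rfl
  ext n
  simp only [Finset.mem_filter, Finset.mem_univ, true_and]
  exact ⟨fun h => ⟨h ▸ hg, h⟩, fun h => h.2⟩

/-- A uniform division into groups averages out the deviations `b n` of the honest clients, which
sum to zero. -/
theorem sum_grouping_le (hm : 0 < m) {byz : Finset (Fin N)} (hG : (byz.card : ℝ) < G)
    (b : Fin N → E) (hb0 : ∑ n ∈ byzᶜ, b n = 0) {D : ℝ} (hb : ∀ n ∉ byz, ‖b n‖ ^ 2 ≤ D)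
    (hD : 0 ≤ D) :
    ∑ a ∈ balancedFinset (Fin N) G m, ‖(1 / ((honestGroups byz a).card : ℝ)) •
        ∑ g ∈ honestGroups byz a, (1 / (m : ℝ)) •
          ∑ n ∈ Finset.univ.filter (fun n => a n = g), b n‖ ^ 2
      ≤ (balancedFinset (Fin N) G m).card * (D / (G - byz.card)) := by
  classical
  set C := balancedFinset (Fin N) G m
  have hm1 : (1 : ℝ) ≤ m := by exact_mod_cast hm
  have hm0 : (0 : ℝ) < m := by linarith
  let φ : (Fin N → Fin G) → ℝ := fun a => (1 / ((honestGroups byz a).card * (m : ℝ))) ^ 2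
  let I : (Fin N → Fin G) → Fin N → Fin N → ℝ := fun a n n' =>
    if a n ∈ honestGroups byz a ∧ a n' ∈ honestGroups byz a then 1 else 0
  let W : Fin N → Fin N → ℝ := fun n n' => ∑ a ∈ C, φ a * I a n n'
  have hsum : ∑ a ∈ C, ‖(1 / ((honestGroups byz a).card : ℝ)) •
        ∑ g ∈ honestGroups byz a, (1 / (m : ℝ)) •
          ∑ n ∈ Finset.univ.filter (fun n => a n = g), b n‖ ^ 2
      = ∑ n ∈ byzᶜ, ∑ n' ∈ byzᶜ, W n n' * ⟪b n, b n'⟫_ℝ := by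
    have h1 : ∀ a ∈ C, ‖(1 / ((honestGroups byz a).card : ℝ)) •
        ∑ g ∈ honestGroups byz a, (1 / (m : ℝ)) •
          ∑ n ∈ Finset.univ.filter (fun n => a n = g), b n‖ ^ 2
        = ∑ n ∈ byzᶜ, ∑ n' ∈ byzᶜ, φ a * I a n n' * ⟪b n, b n'⟫_ℝ := by
      intro a _
      rw [← Finset.smul_sum, sum_honestGroups_sum, smul_smul, norm_smul, mul_pow, Real.norm_eq_abs,
        sq_abs, norm_sum_sq, Finset.mul_sum]
      refine Finset.sum_congr rfl fun n _ => ?_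
      rw [Finset.mul_sum]
      refine Finset.sum_congr rfl fun n' _ => ?_
      rw [one_div_mul_one_div, mul_assoc]
      congr 1
      by_cases h : a n ∈ honestGroups byz a <;> by_cases h' : a n' ∈ honestGroups byz a <;>
        simp [I, h, h']
    rw [Finset.sum_congr rfl h1, Finset.sum_comm]
    refine Finset.sum_congr rfl fun n _ => ?_
    rw [Finset.sum_comm]
    refine Finset.sum_congr rfl fun n' _ => ?_
    rw [← Finset.sum_mul]
  have hWnn : ∀ n n', 0 ≤ W n n' := fun n n' => Finset.sum_nonneg fun a _ => mul_nonneg (by positivity)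
      (by simp only [I]; split_ifs <;> norm_num)
  obtain ⟨α, β, hβ, hαβ⟩ := exists_eq_of_swap_invariant byzᶜ W
    hWnn
    (by
      intro i hi j hj n n'
      rw [Finset.mem_compl] at hi hj
      simp only [W]
      rw [← sum_balanced_comp_perm (Equiv.swap i j) (by simp) (fun a => φ a * I a n n')]
      refine Finset.sum_congr rfl fun a _ => ?_
      simp only [φ, I, honestGroups_comp_swap byz a hi hj, Function.comp])
  -- The `β` part of the form multiplies `‖∑ b n‖²`, which vanishes by centring.
  have hquad : ∑ n ∈ byzᶜ, ∑ n' ∈ byzᶜ, W n n' * ⟪b n, b n'⟫_ℝ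
      = (α - β) * ∑ n ∈ byzᶜ, ‖b n‖ ^ 2 := by
    have h1 : ∑ n ∈ byzᶜ, ∑ n' ∈ byzᶜ, W n n' * ⟪b n, b n'⟫_ℝ
        = ∑ n ∈ byzᶜ, ∑ n' ∈ byzᶜ, (if n = n' then α else β) * ⟪b n, b n'⟫_ℝ :=
      Finset.sum_congr rfl fun i hi => Finset.sum_congr rfl fun j hj => by rw [hαβ i hi j hj]
    rw [h1, sum_kernel_mul_inner, hb0, norm_zero]
    ring
  have hsq : 0 ≤ ∑ n ∈ byzᶜ, ‖b n‖ ^ 2 := Finset.sum_nonneg fun _ _ => by positivity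
  have hdiag : α * ∑ n ∈ byzᶜ, ‖b n‖ ^ 2 ≤ D * ∑ n ∈ byzᶜ, W n n := by
    rw [Finset.mul_sum, Finset.mul_sum]
    refine Finset.sum_le_sum fun n hn => ?_
    have hα : W n n = α := by rw [hαβ n hn n hn, if_pos rfl]
    rw [← hα, mul_comm]
    exact mul_le_mul_of_nonneg_right (hb n (Finset.mem_compl.1 hn)) (hWnn n n)
  have htrace : ∑ n ∈ byzᶜ, W n n ≤ C.card * (1 / (G - byz.card)) := by
    simp only [W]
    rw [Finset.sum_comm, ← nsmul_eq_mul]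
    refine Finset.sum_le_card_nsmul _ _ _ fun a ha => ?_
    have hh := sub_card_le_card_honestGroups byz a
    have hpos : (0 : ℝ) < G - byz.card := by linarith
    have hhpos : (0 : ℝ) < (honestGroups byz a).card := by linarith
    rw [← Finset.mul_sum]
    simp only [I, and_self]
    rw [sum_honest_indicator byz (mem_balancedFinset.1 ha)]
    have : φ a * ((honestGroups byz a).card * m) = 1 / ((honestGroups byz a).card * m) := by
      simp only [φ]; field_simp
    rw [this]
    -- The trace for one division is `1 / (h m)` with `h ≥ G - B` honest groups; the factor `1 / m`
    -- is given away.
    apply one_div_le_one_div_of_le hpos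
    nlinarith
  calc _ = (α - β) * ∑ n ∈ byzᶜ, ‖b n‖ ^ 2 := by rw [hsum, hquad]
    -- The kernel is non-negative, so `β ≥ 0` can be dropped.
    _ ≤ α * ∑ n ∈ byzᶜ, ‖b n‖ ^ 2 := by
      apply mul_le_mul_of_nonneg_right _ hsq; linarith
    _ ≤ _ := hdiag
    _ ≤ D * (C.card * (1 / (G - byz.card))) := by gcongr
    _ = _ := by ring

end Grouping

/-! ### Robustness of the geometric median -/

section GeometricMedian

variable {p : ℕ}

/-- A geometric median is close to any point `v` that is close to the vectors of a majority. -/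
theorem IsGeomMedian.norm_sub_le {ι : Type*} [Fintype ι] [DecidableEq ι] {u : ι → Param p}
    {z : Param p} (hz : IsGeomMedian u z) (S : Finset ι) (v : Param p) :
    ((S.card : ℝ) - Sᶜ.card) * ‖z - v‖ ≤ 2 * ∑ i ∈ S, ‖u i - v‖ := by
  -- The objective at `z` is at most that at `v`. The triangle inequality bounds the terms in `S`
  -- from below by `‖z - v‖ - ‖u i - v‖`, and those outside `S` cost at most `‖z - v‖` each,
  -- whatever the outliers are.
  have h1 : ∑ i, ‖z - u i‖ ≤ ∑ i, ‖v - u i‖ := hz (Set.mem_univ v)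
  rw [← Finset.sum_add_sum_compl S, ← Finset.sum_add_sum_compl S (fun i => ‖v - u i‖)] at h1
  have h2 : ∑ i ∈ S, (‖z - v‖ - ‖u i - v‖) ≤ ∑ i ∈ S, ‖z - u i‖ := by
    refine Finset.sum_le_sum fun i _ => ?_
    have := norm_sub_le_norm_sub_add_norm_sub z (u i) v
    linarith
  have h3 : ∑ i ∈ Sᶜ, (‖v - u i‖ - ‖z - v‖) ≤ ∑ i ∈ Sᶜ, ‖z - u i‖ := by
    refine Finset.sum_le_sum fun i _ => ?_
    have := norm_sub_le_norm_sub_add_norm_sub v z (u i)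
    rw [norm_sub_rev v z] at this
    linarith
  have h4 : ∑ i ∈ S, ‖v - u i‖ = ∑ i ∈ S, ‖u i - v‖ :=
    Finset.sum_congr rfl fun i _ => norm_sub_rev _ _
  rw [Finset.sum_sub_distrib, Finset.sum_const, nsmul_eq_mul] at h2 h3
  linarith

/-- The constant `2(G - b)/(G - 2b)` for `b` outliers increases with `b`, so the actual number of
outliers may be replaced by an upper bound `x`. -/
theorem medianConst_mono_bound {G b x : ℝ} (hG : 0 < G) (hb : b ≤ x) (hx : 2 * x < G) :
    2 * (G - b) / (G - 2 * b) ≤ medianConst (x / G) := by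
  have h1 : medianConst (x / G) = 2 * (G - x) / (G - 2 * x) := by
    have : 1 - 2 * (x / G) ≠ 0 := by
      have : x / G < 1 / 2 := by rw [div_lt_iff₀ hG]; linarith
      linarith
    have h2 : G - 2 * x ≠ 0 := by linarith
    rw [medianConst, div_eq_div_iff this h2]
    field_simp
  rw [h1, div_le_div_iff₀ (by linarith) (by linarith)]
  nlinarith

/-- The squared error of the geometric median in terms of the mean squared error of a majority. -/
theorem IsGeomMedian.norm_sub_sq_le {G : ℕ} {u : Fin G → Param p} {z : Param p}
    (hz : IsGeomMedian u z) (S : Finset (Fin G)) (v : Param p) {x : ℝ} (hx : 2 * x < G)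
    (hS : (Sᶜ.card : ℝ) ≤ x) :
    ‖z - v‖ ^ 2 ≤ medianConst (x / G) ^ 2 * ((1 / (S.card : ℝ)) * ∑ i ∈ S, ‖u i - v‖ ^ 2) := by
  have hcard : (S.card : ℝ) + Sᶜ.card = G := by
    have := Finset.card_add_card_compl S
    rw [Fintype.card_fin] at this
    exact_mod_cast this
  have hb0 : (0 : ℝ) ≤ Sᶜ.card := Nat.cast_nonneg _
  have hG : (0 : ℝ) < G := by linarith
  have hS0 : (0 : ℝ) < S.card := by linarith
  have h1 := hz.norm_sub_le S v
  set M := (1 / (S.card : ℝ)) * ∑ i ∈ S, ‖u i - v‖ with hM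
  have hM0 : 0 ≤ M := by positivity
  have hMS : ∑ i ∈ S, ‖u i - v‖ = S.card * M := by rw [hM]; field_simp
  have h2 : ‖z - v‖ ≤ 2 * (G - Sᶜ.card) / (G - 2 * Sᶜ.card) * M := by
    rw [div_mul_eq_mul_div, le_div_iff₀ (by linarith)]
    have e1 : (S.card : ℝ) = G - Sᶜ.card := by linarith
    rw [hMS, e1] at h1
    linarith
  have h3 : ‖z - v‖ ≤ medianConst (x / G) * M :=
    h2.trans (mul_le_mul_of_nonneg_right (medianConst_mono_bound hG hS hx) hM0)
  have h4 : M ^ 2 ≤ (1 / (S.card : ℝ)) * ∑ i ∈ S, ‖u i - v‖ ^ 2 := by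
    have := norm_average_sq_le S (fun i => ‖u i - v‖)
    simpa [hM, mul_pow] using this
  calc ‖z - v‖ ^ 2 ≤ (medianConst (x / G) * M) ^ 2 := by gcongr
    _ = medianConst (x / G) ^ 2 * M ^ 2 := by ring
    _ ≤ _ := by gcongr

end GeometricMedian

/-! ### Integrals against uniform laws -/

theorem integral_uniformOn {α : Type*} [MeasurableSpace α] [MeasurableSingletonClass α] [Fintype α]
    (S : Finset α) (f : α → ℝ) :
    ∫ a, f a ∂(uniformOn (S : Set α)) = (1 / (S.card : ℝ)) * ∑ a ∈ S, f a := by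
  classical
  rw [integral_fintype .of_finite]
  have h : ∀ a, (uniformOn (S : Set α)).real {a} = if a ∈ S then 1 / (S.card : ℝ) else 0 := by
    intro a
    rw [measureReal_def, ← Finset.coe_singleton, uniformOn_apply_finset]
    by_cases ha : a ∈ S
    · rw [Finset.inter_singleton_of_mem ha]
      simp [ha]
    · rw [Finset.inter_singleton_of_notMem ha]
      simp [ha]
  simp_rw [h, smul_eq_mul, ite_mul, zero_mul]
  rw [Finset.sum_ite_mem, Finset.univ_inter, Finset.mul_sum]

theorem lintegral_uniformOn {α : Type*} [MeasurableSpace α] [MeasurableSingletonClass α] [Fintype α]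
    (S : Finset α) (f : α → ℝ) (hf : ∀ a, 0 ≤ f a) :
    ∫⁻ a, ENNReal.ofReal (f a) ∂(uniformOn (S : Set α))
      = ENNReal.ofReal ((1 / (S.card : ℝ)) * ∑ a ∈ S, f a) := by
  rw [← integral_uniformOn, ofReal_integral_eq_lintegral_ofReal .of_finite (ae_of_all _ hf)]

theorem ae_mem_uniformOn {α : Type*} [MeasurableSpace α] [MeasurableSingletonClass α] [Finite α]
    (S : Set α) : ∀ᵐ a ∂(uniformOn S), a ∈ S :=
  ae_cond_mem S.toFinite.measurableSet

/-! ### Second moments of sums of independent centred vectors -/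

section Pi

variable {p : ℕ} {ι : Type*} [Fintype ι] {X : ι → Type*} [∀ i, MeasurableSpace (X i)]
  {μ : ∀ i, Measure (X i)} [∀ i, IsProbabilityMeasure (μ i)] {f : ∀ i, X i → Param p}

theorem memLp_const_add_sum_pi (hf : ∀ i, MemLp (f i) 2 (μ i)) (b : Param p) :
    MemLp (fun x : ∀ i, X i => b + ∑ i, f i (x i)) 2 (Measure.pi μ) := by
  refine (memLp_const b).add (memLp_finsetSum _ fun i _ => ?_)
  exact (hf i).comp_measurePreserving (measurePreserving_eval μ i)

/-- The second moment of a sum of independent centred vectors and a constant. -/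
theorem integral_norm_const_add_sum_pi_sq (hf : ∀ i, MemLp (f i) 2 (μ i))
    (h0 : ∀ i, ∫ x, f i x ∂(μ i) = 0) (b : Param p) :
    ∫ x : ∀ i, X i, ‖b + ∑ i, f i (x i)‖ ^ 2 ∂(Measure.pi μ)
      = ‖b‖ ^ 2 + ∑ i, ∫ x, ‖f i x‖ ^ 2 ∂(μ i) := by
  have hcoord : ∀ i l, MemLp (fun x => f i x l) 2 (μ i) := fun i l =>
    memLp_piLp_iff.1 (hf i) l
  have hmean : ∀ i l, ∫ x, f i x l ∂(μ i) = 0 := by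
    intro i l
    have := (EuclideanSpace.proj (𝕜 := ℝ) l).integral_comp_comm ((hf i).integrable one_le_two)
    simpa [h0 i] using this
  have hpi : ∀ i l, MemLp (fun x : ∀ i, X i => f i (x i) l) 2 (Measure.pi μ) := fun i l =>
    (hcoord i l).comp_measurePreserving (measurePreserving_eval μ i)
  have hsum : ∀ l, MemLp (fun x : ∀ i, X i => ∑ i, f i (x i) l) 2 (Measure.pi μ) := fun l =>
    memLp_finsetSum _ fun i _ => hpi i l
  have hsummean : ∀ l, ∫ x : ∀ i, X i, ∑ i, f i (x i) l ∂(Measure.pi μ) = 0 := by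
    intro l
    rw [integral_finsetSum _ fun i _ => (hpi i l).integrable one_le_two]
    refine Finset.sum_eq_zero fun i _ => ?_
    rw [integral_comp_eval (μ := μ) (f := fun y => f i y l) (hcoord i l).aestronglyMeasurable,
      hmean]
  -- In each coordinate the second moment of a centred sum is its variance, which is additive over
  -- the independent factors.
  have hsumsq : ∀ l, ∫ x : ∀ i, X i, (∑ i, f i (x i) l) ^ 2 ∂(Measure.pi μ)
      = ∑ i, ∫ x, f i x l ^ 2 ∂(μ i) := by
    intro l
    have h1 := variance_sum_pi (X := fun i x => f i x l) (fun i => hcoord i l)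
    have h2 : (∑ i, fun x : ∀ i, X i => f i (x i) l) = fun x => ∑ i, f i (x i) l := by
      ext x; simp
    rw [h2, variance_of_integral_eq_zero (hsum l).aemeasurable (hsummean l)] at h1
    rw [h1]
    exact Finset.sum_congr rfl fun i _ =>
      variance_of_integral_eq_zero (hcoord i l).aemeasurable (hmean i l)
  have hone : ∀ l, ∫ x : ∀ i, X i, (b l + ∑ i, f i (x i) l) ^ 2 ∂(Measure.pi μ)
      = b l ^ 2 + ∑ i, ∫ x, f i x l ^ 2 ∂(μ i) := by
    intro l
    have h1 : ∀ x : ∀ i, X i, (b l + ∑ i, f i (x i) l) ^ 2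
        = (b l ^ 2 + 2 * b l * ∑ i, f i (x i) l) + (∑ i, f i (x i) l) ^ 2 := fun x => by ring
    simp_rw [h1]
    rw [integral_add _ (hsum l).integrable_sq, integral_add (integrable_const _),
      integral_const_mul, hsummean, hsumsq]
    · simp
    · exact ((hsum l).integrable one_le_two).const_mul _
    · exact (integrable_const _).add (((hsum l).integrable one_le_two).const_mul _)
  have hexp : ∀ x : ∀ i, X i, ‖b + ∑ i, f i (x i)‖ ^ 2
      = ∑ l, (b l + ∑ i, f i (x i) l) ^ 2 := by
    intro x
    rw [EuclideanSpace.real_norm_sq_eq]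
    simp
  have hint : ∀ l, Integrable (fun x : ∀ i, X i => (b l + ∑ i, f i (x i) l) ^ 2)
      (Measure.pi μ) := fun l => ((memLp_const (b l)).add (hsum l)).integrable_sq
  simp_rw [hexp]
  rw [integral_finsetSum _ fun l _ => hint l,
    Finset.sum_congr rfl fun l _ => hone l, Finset.sum_add_distrib,
    ← EuclideanSpace.real_norm_sq_eq, Finset.sum_comm]
  congr 1
  refine Finset.sum_congr rfl fun i _ => ?_
  simp_rw [EuclideanSpace.real_norm_sq_eq]
  rw [integral_finsetSum _ fun l _ => (hcoord i l).integrable_sq]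

end Pi

/-! ### Second moment of the channel noise -/

theorem memLp_id_gaussian {p : ℕ} (S : Matrix (Fin p) (Fin p) ℝ) :
    MemLp (fun x => x) 2 (multivariateGaussian (0 : Param p) S) := IsGaussian.memLp_two_id

theorem integral_norm_sq_gaussian {p : ℕ} (σ : ℝ) :
    ∫ x, ‖x‖ ^ 2 ∂(multivariateGaussian (0 : Param p) (σ ^ 2 • (1 : Matrix (Fin p) (Fin p) ℝ)))
      = p * σ ^ 2 := by
  have hS : (σ ^ 2 • (1 : Matrix (Fin p) (Fin p) ℝ)).PosSemidef :=
    Matrix.PosSemidef.one.smul (sq_nonneg σ)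
  set γ := multivariateGaussian (0 : Param p) (σ ^ 2 • (1 : Matrix (Fin p) (Fin p) ℝ))
  have hmem : ∀ l, MemLp (fun x : Param p => x l) 2 γ := fun l =>
    (EuclideanSpace.proj (𝕜 := ℝ) l).comp_memLp' (memLp_id_gaussian _)
  have h1 : ∀ l, ∫ x : Param p, x l ^ 2 ∂γ = σ ^ 2 := by
    intro l
    have hv := variance_eval_multivariateGaussian (μ := (0 : Param p)) hS l
    have hmean : ∫ x : Param p, x l ∂γ = 0 := by
      have := (EuclideanSpace.proj (𝕜 := ℝ) l).integral_comp_comm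
        ((memLp_id_gaussian (p := p) (σ ^ 2 • 1)).integrable one_le_two)
      simpa using this
    rw [variance_of_integral_eq_zero (hmem l).aemeasurable hmean] at hv
    simpa using hv
  simp_rw [EuclideanSpace.real_norm_sq_eq]
  rw [integral_finsetSum _ fun l _ => (hmem l).integrable_sq, Finset.sum_congr rfl fun l _ => h1 l]
  simp

/-! ### Gradients and the perturbed gradient step -/

section Gradients

variable {p N : ℕ} {Ξ : Type*} {F : Federation p N Ξ}

theorem hasGradientAt_average {ι : Type*} (S : Finset ι) (f : ι → Param p → ℝ) (c : ℝ) (x : Param p)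
    (hf : ∀ i ∈ S, DifferentiableAt ℝ (f i) x) :
    HasGradientAt (fun y => (∑ i ∈ S, f i y) / c) ((1 / c) • ∑ i ∈ S, gradient (f i) x) x := by
  rw [hasGradientAt_iff_hasFDerivAt]
  have h1 : HasFDerivAt (fun y => ∑ i ∈ S, f i y) (∑ i ∈ S, fderiv ℝ (f i) x) x :=
    HasFDerivAt.fun_sum fun i hi => (hf i hi).hasFDerivAt
  have h2 := h1.const_mul (1 / c)
  have h3 : (fun y => 1 / c * ∑ i ∈ S, f i y) = fun y => (∑ i ∈ S, f i y) / c := by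
    ext y; ring
  rw [h3] at h2
  have h4 : InnerProductSpace.toDual ℝ (Param p) ((1 / c) • ∑ i ∈ S, gradient (f i) x)
      = (1 / c) • ∑ i ∈ S, fderiv ℝ (f i) x := by
    simp [gradient, map_sum]
  rw [h4]
  exact h2

theorem measurable_gradient (f : Param p → ℝ) : Measurable (gradient f) :=
  (InnerProductSpace.toDual ℝ (Param p)).symm.continuous.measurable.comp (measurable_fderiv ℝ f)

theorem measurable_stochGrad (n : Fin N) (j : Fin (F.size n)) : Measurable (F.stochGrad n j) :=
  measurable_gradient _

theorem differentiable_localLoss (hdiff : F.DifferentiableLosses) {n : Fin N} (hn : n ∉ F.byz) :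
    Differentiable ℝ (F.localLoss n) := fun x =>
  (hasGradientAt_average Finset.univ (fun j y => F.loss n y (F.data n j)) _ x
    fun j _ => hdiff n hn j x).differentiableAt

theorem gradient_localLoss (hdiff : F.DifferentiableLosses) {n : Fin N} (hn : n ∉ F.byz)
    (x : Param p) :
    gradient (F.localLoss n) x = (1 / (F.size n : ℝ)) • ∑ j, F.stochGrad n j x :=
  (hasGradientAt_average Finset.univ (fun j y => F.loss n y (F.data n j)) _ x
    fun j _ => hdiff n hn j x).gradient

theorem gradient_globalLoss (hdiff : F.DifferentiableLosses) (x : Param p) :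
    gradient F.globalLoss x
      = (1 / (F.byzᶜ.card : ℝ)) • ∑ n ∈ F.byzᶜ, gradient (F.localLoss n) x :=
  (hasGradientAt_average F.byzᶜ F.localLoss _ x
    fun _ hn => differentiable_localLoss hdiff (Finset.mem_compl.1 hn) x).gradient

theorem sum_stochGrad_sub (hdiff : F.DifferentiableLosses) {n : Fin N} (hn : n ∉ F.byz)
    (x : Param p) : ∑ j, (F.stochGrad n j x - gradient (F.localLoss n) x) = 0 := by
  have hpos : (F.size n : ℝ) ≠ 0 := by exact_mod_cast (F.size_pos n).ne'
  rw [Finset.sum_sub_distrib, Finset.sum_const, Finset.card_univ, Fintype.card_fin,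
    gradient_localLoss hdiff hn, ← Nat.cast_smul_eq_nsmul ℝ, smul_smul, mul_one_div_cancel hpos,
    one_smul, sub_self]

/-- The global loss averages exactly the honest clients, so their deviations cancel. This is the
centring required by `sum_grouping_le`. -/
theorem sum_gradient_localLoss_sub (hdiff : F.DifferentiableLosses) (x : Param p) :
    ∑ n ∈ F.byzᶜ, (gradient (F.localLoss n) x - gradient F.globalLoss x) = 0 := by
  rcases F.byzᶜ.eq_empty_or_nonempty with h | h
  · simp [h]
  have hpos : (F.byzᶜ.card : ℝ) ≠ 0 := by exact_mod_cast h.card_pos.ne'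
  rw [Finset.sum_sub_distrib, Finset.sum_const, gradient_globalLoss hdiff,
    ← Nat.cast_smul_eq_nsmul ℝ, smul_smul, mul_one_div_cancel hpos, one_smul, sub_self]

theorem gradient_eq_zero_of_isMinOn {f : Param p → ℝ} {x : Param p} (h : IsMinOn f Set.univ x) :
    gradient f x = 0 := by
  have : IsLocalMin f x := h.isLocalMin Filter.univ_mem
  rw [gradient, this.fderiv_eq_zero, map_zero]

/-- One exact gradient step contracts the squared distance to the minimizer. -/
theorem norm_gradientStep_sub_sq_le {μ L η : ℝ} (hconv : F.StronglyConvex μ)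
    (hlip : F.LipschitzGradient L) {wstar : Param p} (hstar : IsMinOn F.globalLoss Set.univ wstar)
    (hη : 0 ≤ η) (x : Param p) :
    ‖x - η • gradient F.globalLoss x - wstar‖ ^ 2
      ≤ (1 - 2 * (η * μ) + η ^ 2 * L ^ 2) * ‖x - wstar‖ ^ 2 := by
  have h0 := gradient_eq_zero_of_isMinOn hstar
  -- Adding the strong convexity inequalities in the two directions gives `⟪∇f(x), x - w*⟫ ≥ μ ‖x -
  -- w*‖²`, the source of the term `2ημ`.
  have h1 := hconv wstar x
  have h2 := hconv x wstar
  have h3 := hlip x wstar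
  rw [h0, inner_zero_left, add_zero] at h2
  rw [h0, sub_zero] at h3
  have h4 : ⟪gradient F.globalLoss x, wstar - x⟫_ℝ = -⟪gradient F.globalLoss x, x - wstar⟫_ℝ := by
    rw [← inner_neg_right, neg_sub]
  rw [h4, norm_sub_rev wstar x] at h1
  have h5 : ‖gradient F.globalLoss x‖ ^ 2 ≤ L ^ 2 * ‖x - wstar‖ ^ 2 := by
    rw [← mul_pow]; gcongr
  have h6 : x - η • gradient F.globalLoss x - wstar
      = (x - wstar) - η • gradient F.globalLoss x := by abel
  rw [h6, norm_sub_sq_real, inner_smul_right, real_inner_comm, norm_smul, mul_pow,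
    Real.norm_eq_abs, sq_abs]
  have h7 := mul_le_mul_of_nonneg_left h5 (sq_nonneg η)
  have h8 : η * (μ * ‖x - wstar‖ ^ 2) ≤ η * ⟪gradient F.globalLoss x, x - wstar⟫_ℝ :=
    mul_le_mul_of_nonneg_left (by linarith) hη
  linarith

/-- Young's inequality: after the triangle inequality, the gap is the square `(θ‖a‖ - (1 - θ)‖b‖)²`
over `θ(1 - θ)`. -/
theorem norm_add_sq_le_of_lt_one {E : Type*} [NormedAddCommGroup E] [InnerProductSpace ℝ E]
    (a b : E) {θ : ℝ} (h0 : 0 < θ) (h1 : θ < 1) :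
    ‖a + b‖ ^ 2 ≤ 1 / (1 - θ) * ‖a‖ ^ 2 + 1 / θ * ‖b‖ ^ 2 := by
  have h2 : 0 < 1 - θ := by linarith
  have h3 : ‖a + b‖ ^ 2 ≤ (‖a‖ + ‖b‖) ^ 2 := by gcongr; exact norm_add_le a b
  refine h3.trans ?_
  rw [← sub_nonneg]
  have : 1 / (1 - θ) * ‖a‖ ^ 2 + 1 / θ * ‖b‖ ^ 2 - (‖a‖ + ‖b‖) ^ 2
      = (θ * ‖a‖ - (1 - θ) * ‖b‖) ^ 2 / (θ * (1 - θ)) := by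
    field_simp; ring
  rw [this]
  positivity

/-- The squared distance to the minimizer after a perturbed gradient step. -/
theorem norm_perturbedStep_sub_sq_le {μ L η : ℝ} (hμ : 0 < μ) (hL : 0 < L) (hη : 0 < η)
    (hη' : η < min (μ / (2 * L ^ 2)) (2 / μ)) (hconv : F.StronglyConvex μ)
    (hlip : F.LipschitzGradient L) {wstar : Param p} (hstar : IsMinOn F.globalLoss Set.univ wstar)
    (x y : Param p) :
    ‖y - wstar‖ ^ 2 ≤ (1 - η * μ) * ‖x - wstar‖ ^ 2
      + 2 / (η * μ) * ‖y - x - (-η) • gradient F.globalLoss x‖ ^ 2 := by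
  have hη1 : η * (2 * L ^ 2) < μ := by
    rw [← lt_div_iff₀ (by positivity)]; exact hη'.trans_le (min_le_left _ _)
  have hη2 : η * μ < 2 := by
    rw [← lt_div_iff₀ hμ]; exact hη'.trans_le (min_le_right _ _)
  have hημ : 0 < η * μ := by positivity
  have h1 := norm_gradientStep_sub_sq_le hconv hlip hstar hη.le x
  -- The choice `θ = ημ/2` spends part of the contraction on the error; `θ < 1` is where `η < 2/μ`
  -- enters.
  have h2 := norm_add_sq_le_of_lt_one (x - η • gradient F.globalLoss x - wstar)
    (y - x - (-η) • gradient F.globalLoss x) (θ := η * μ / 2) (by linarith) (by linarith)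
  have h3 : x - η • gradient F.globalLoss x - wstar + (y - x - (-η) • gradient F.globalLoss x)
      = y - wstar := by rw [neg_smul]; abel
  rw [h3] at h2
  have h4 : 1 / (1 - η * μ / 2) * ‖x - η • gradient F.globalLoss x - wstar‖ ^ 2
      ≤ (1 - η * μ) * ‖x - wstar‖ ^ 2 := by
    have h5 : 0 < 1 - η * μ / 2 := by linarith
    rw [one_div, inv_mul_le_iff₀ h5]
    refine h1.trans ?_
    -- The right side is `1 - 3ημ/2 + (ημ)²/2`, so `η²L² ≤ ημ/2` suffices; this is the bound `η <
    -- μ/(2L²)`.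
    have h7 : 1 - 2 * (η * μ) + η ^ 2 * L ^ 2 ≤ (1 - η * μ / 2) * (1 - η * μ) := by nlinarith
    calc _ ≤ (1 - η * μ / 2) * (1 - η * μ) * ‖x - wstar‖ ^ 2 :=
          mul_le_mul_of_nonneg_right h7 (sq_nonneg _)
      _ = _ := by ring
  have h6 : 1 / (η * μ / 2) = 2 / (η * μ) := by field_simp
  rw [h6] at h2
  linarith

/-- A bound of linear growth, needed only for integrability: a single sample deviates by at most
`√(m_n κ²)`, since its square is one of the `m_n` terms whose mean is at most `κ²`. -/
theorem norm_stochGrad_le {L δ κ : ℝ} (hlip : F.LipschitzGradient L)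
    (houter : F.BoundedOuterVariation δ) (hinner : F.BoundedInnerVariation κ)
    {wstar : Param p} (hstar : IsMinOn F.globalLoss Set.univ wstar) {n : Fin N} (hn : n ∉ F.byz)
    (j : Fin (F.size n)) (x : Param p) :
    ‖F.stochGrad n j x‖ ≤ √(F.size n * κ ^ 2) + |δ| + L * ‖x - wstar‖ := by
  have hpos : (0 : ℝ) < F.size n := by exact_mod_cast F.size_pos n
  have h1 : ‖F.stochGrad n j x - gradient (F.localLoss n) x‖ ≤ √(F.size n * κ ^ 2) := by
    apply Real.le_sqrt_of_sq_le
    have := hinner n hn x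
    rw [div_le_iff₀ hpos] at this
    have h2 := Finset.single_le_sum
      (f := fun j => ‖F.stochGrad n j x - gradient (F.localLoss n) x‖ ^ 2)
      (fun _ _ => by positivity) (Finset.mem_univ j)
    linarith
  have h2 : ‖gradient (F.localLoss n) x - gradient F.globalLoss x‖ ≤ |δ| :=
    le_abs_self _ |>.trans (sq_le_sq.1 (houter n hn x))
  have h3 := hlip x wstar
  rw [gradient_eq_zero_of_isMinOn hstar, sub_zero] at h3
  have h4 : F.stochGrad n j x = (F.stochGrad n j x - gradient (F.localLoss n) x)
      + (gradient (F.localLoss n) x - gradient F.globalLoss x) + gradient F.globalLoss x := by abel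
  rw [h4]
  exact (norm_add₃_le).trans (by gcongr)

end Gradients

/-! ### The error of a round: definitions, noise and sampling -/

section RoundError

variable {p N G s : ℕ} {Ξ : Type*} (F : Federation p N Ξ)

/-- The deviation, scaled by `-η`, of the stochastic gradient of client `n` from the gradient of the
global loss. -/
noncomputable def clientError (η : ℝ) (x : Param p) (n : Fin N) (j : Fin (F.size n)) : Param p :=
  (-η) • (F.stochGrad n j x - gradient F.globalLoss x)

/-- The error of the update of a group without Byzantine clients, as an estimate of
`-η ∇f(x)`, when the noise is multiplied by `r`. -/
noncomputable def groupError (m : ℕ) (η r : ℝ) (x : Param p) (ζ : Seed F G s) (g : Fin G) :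
    Param p :=
  (1 / (m : ℝ)) • ∑ n ∈ Finset.univ.filter (fun n => ζ.group n = g),
    clientError F η x n (ζ.sample n) + r • ζ.noise g

/-- The mean squared error of the good messages after resampling. -/
noncomputable def meanGoodError (m : ℕ) (η r : ℝ) (x : Param p) (ζ : Seed F G s) : ℝ :=
  (1 / ((goodMessages (honestGroups F.byz ζ.group) ζ.resample).card : ℝ)) *
    ∑ k ∈ goodMessages (honestGroups F.byz ζ.group) ζ.resample,
      ‖∑ g, resampleWeight ζ.resample k g • groupError F m η r x ζ g‖ ^ 2

theorem meanGoodError_nonneg (m : ℕ) (η r : ℝ) (x : Param p) (ζ : Seed F G s) :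
    0 ≤ meanGoodError F m η r x ζ := by
  unfold meanGoodError; positivity

/-- Joint measurability in model and seed is what Tonelli requires. The combinatorial quantities are
functions on a finite space, and a map that is measurable in the model for each sample index is
jointly measurable. -/
theorem measurable_meanGoodError (m : ℕ) (η r : ℝ) :
    Measurable fun q : Param p × Seed F G s => meanGoodError F m η r q.1 q.2 := by
  have hcl : ∀ n, Measurable fun q : Param p × Seed F G s =>
      clientError F η q.1 n (q.2.sample n) := by
    intro n
    have h1 : Measurable fun y : Param p × Fin (F.size n) => clientError F η y.1 n y.2 := by
      refine measurable_from_prod_countable_left fun j => ?_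
      exact ((measurable_stochGrad n j).sub (measurable_gradient _)).const_smul (-η)
    have h2 : Measurable fun q : Param p × Seed F G s => q.2.sample n :=
      (measurable_pi_apply n).comp measurable_snd.snd.snd.fst
    exact Measurable.comp (g := fun y : Param p × Fin (F.size n) => clientError F η y.1 n y.2)
      (f := fun q : Param p × Seed F G s => (q.1, q.2.sample n)) h1 (measurable_fst.prodMk h2)
  have hgr : ∀ n, Measurable fun q : Param p × Seed F G s => q.2.group n := by
    intro n; unfold Seed.group; fun_prop
  have hres : Measurable fun q : Param p × Seed F G s => (q.2.group, q.2.resample) := by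
    unfold Seed.group Seed.resample; fun_prop
  have hge : ∀ g, Measurable fun q : Param p × Seed F G s => groupError F m η r q.1 q.2 g := by
    intro g
    have h1 : Measurable fun q : Param p × Seed F G s =>
        ∑ n ∈ Finset.univ.filter (fun n => q.2.group n = g),
          clientError F η q.1 n (q.2.sample n) := by
      simp_rw [Finset.sum_filter]
      refine Finset.measurable_sum _ fun n _ => ?_
      exact Measurable.ite (hgr n (measurableSet_singleton g)) (hcl n) measurable_const
    have h2 : Measurable fun q : Param p × Seed F G s => q.2.noise g :=
      (measurable_pi_apply g).comp measurable_snd.snd.snd.snd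
    exact (h1.const_smul (1 / (m : ℝ))).add (h2.const_smul r)
  have hdisc : ∀ φ : (Fin N → Fin G) × (Fin G × Fin s → Fin G) → ℝ,
      Measurable fun q : Param p × Seed F G s => φ (q.2.group, q.2.resample) := fun φ =>
    (measurable_of_finite φ).comp hres
  unfold meanGoodError
  refine Measurable.mul (hdisc fun y =>
    1 / ((goodMessages (honestGroups F.byz y.1) y.2).card : ℝ)) ?_
  have hrw : ∀ q : Param p × Seed F G s,
      ∑ k ∈ goodMessages (honestGroups F.byz q.2.group) q.2.resample,
        ‖∑ g, resampleWeight q.2.resample k g • groupError F m η r q.1 q.2 g‖ ^ 2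
      = ∑ k, (if k ∈ goodMessages (honestGroups F.byz q.2.group) q.2.resample then (1 : ℝ) else 0) *
        ‖∑ g, resampleWeight q.2.resample k g • groupError F m η r q.1 q.2 g‖ ^ 2 := by
    intro q
    simp [ite_mul]
  simp_rw [hrw]
  refine Finset.measurable_sum _ fun k _ => Measurable.mul (hdisc fun y =>
    if k ∈ goodMessages (honestGroups F.byz y.1) y.2 then (1 : ℝ) else 0) ?_
  refine Measurable.pow_const (Measurable.norm (Finset.measurable_sum _ fun g _ => ?_)) 2
  exact (hdisc fun y => resampleWeight y.2 k g).smul (hge g)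

theorem sum_weight_smul_groupError (m : ℕ) (η r : ℝ) (x : Param p) (a : Fin N → Fin G)
    (c : Fin G × Fin s → Fin G) (j : ∀ n, Fin (F.size n)) (z : Fin G → Param p)
    (q : Fin G → ℝ) :
    ∑ g, q g • groupError F m η r x ((a, c, j, z) : Seed F G s) g
      = ∑ n, (q (a n) / m) • clientError F η x n (j n) + ∑ g, (q g * r) • z g := by
  simp only [groupError, smul_add, Finset.sum_add_distrib, smul_smul, Seed.group, Seed.sample,
    Seed.noise]
  congr 1
  rw [← Finset.sum_fiberwise Finset.univ a]
  refine Finset.sum_congr rfl fun g _ => ?_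
  rw [Finset.smul_sum]
  refine Finset.sum_congr rfl fun n hn => ?_
  rw [(Finset.mem_filter.1 hn).2, mul_one_div]

/-- The integral over the noises. -/
theorem integral_noise (b : Param p) (q : Fin G → ℝ) (σ : ℝ) :
    ∫ z : Fin G → Param p, ‖b + ∑ g, q g • z g‖ ^ 2
        ∂(Measure.pi fun _ => multivariateGaussian 0 (σ ^ 2 • (1 : Matrix (Fin p) (Fin p) ℝ)))
      = ‖b‖ ^ 2 + p * σ ^ 2 * ∑ g, q g ^ 2 := by
  rw [integral_norm_const_add_sum_pi_sq (f := fun g (y : Param p) => q g • y)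
    (fun g => (memLp_id_gaussian _).const_smul (q g)) (fun g => by rw [integral_smul]; simp)]
  congr 1
  rw [Finset.mul_sum]
  refine Finset.sum_congr rfl fun g _ => ?_
  simp_rw [norm_smul, mul_pow, Real.norm_eq_abs, sq_abs]
  rw [integral_const_mul, integral_norm_sq_gaussian]
  ring

theorem integrable_noise (b : Param p) (q : Fin G → ℝ) (σ : ℝ) :
    Integrable (fun z : Fin G → Param p => ‖b + ∑ g, q g • z g‖ ^ 2)
      (Measure.pi fun _ => multivariateGaussian 0 (σ ^ 2 • (1 : Matrix (Fin p) (Fin p) ℝ))) :=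
  (memLp_const_add_sum_pi (f := fun g (y : Param p) => q g • y)
    (fun g => (memLp_id_gaussian _).const_smul (q g)) b).integrable_norm_pow two_ne_zero

variable {F}

instance size_nonempty (n : Fin N) : Nonempty (Fin (F.size n)) := ⟨⟨0, F.size_pos n⟩⟩

theorem integral_sample {E : Type*} [NormedAddCommGroup E] [NormedSpace ℝ E] [CompleteSpace E]
    (n : Fin N) (f : Fin (F.size n) → E) :
    ∫ j, f j ∂(uniformOn (Set.univ : Set (Fin (F.size n)))) = (1 / (F.size n : ℝ)) • ∑ j, f j := by
  rw [integral_fintype .of_finite, Finset.smul_sum]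
  refine Finset.sum_congr rfl fun j _ => ?_
  congr 1
  rw [measureReal_def, uniformOn_univ]
  simp

/-- The integral over the sample indices. -/
theorem integral_samples_le (hdiff : F.DifferentiableLosses) {κ : ℝ}
    (hinner : F.BoundedInnerVariation κ) (η : ℝ) (x : Param p) (q : Fin N → ℝ)
    (hq : ∀ n ∈ F.byz, q n = 0) :
    ∫ j : ∀ n, Fin (F.size n), ‖∑ n, q n • clientError F η x n (j n)‖ ^ 2
        ∂(Measure.pi fun n => uniformOn (Set.univ : Set (Fin (F.size n))))
      ≤ ‖∑ n, q n • (-η) • (gradient (F.localLoss n) x - gradient F.globalLoss x)‖ ^ 2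
        + η ^ 2 * κ ^ 2 * ∑ n, q n ^ 2 := by
  have hrw : ∀ j : ∀ n, Fin (F.size n), ∑ n, q n • clientError F η x n (j n)
      = ∑ n, q n • (-η) • (gradient (F.localLoss n) x - gradient F.globalLoss x)
        + ∑ n, (q n * (-η)) • (F.stochGrad n (j n) x - gradient (F.localLoss n) x) := by
    intro j
    rw [← Finset.sum_add_distrib]
    refine Finset.sum_congr rfl fun n _ => ?_
    rw [clientError, mul_smul, ← smul_add, ← smul_add]
    congr 2
    abel
  simp_rw [hrw]
  rw [integral_norm_const_add_sum_pi_sq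
    (f := fun n (j : Fin (F.size n)) =>
      (q n * (-η)) • (F.stochGrad n j x - gradient (F.localLoss n) x))
    (fun n => MemLp.of_discrete)]
  · gcongr ?_ + ?_
    · exact le_rfl
    rw [Finset.mul_sum]
    refine Finset.sum_le_sum fun n _ => ?_
    -- The variation bound and the centring hold for honest clients only; a Byzantine client has
    -- weight zero.
    by_cases hn : n ∈ F.byz
    · simp [hq n hn]
    · rw [integral_sample]
      simp_rw [norm_smul, mul_pow, Real.norm_eq_abs, sq_abs]
      rw [← Finset.mul_sum, smul_eq_mul]
      have h1 := hinner n hn x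
      calc _ = (q n ^ 2 * η ^ 2) *
            ((∑ j, ‖F.stochGrad n j x - gradient (F.localLoss n) x‖ ^ 2) / F.size n) := by ring
        _ ≤ (q n ^ 2 * η ^ 2) * κ ^ 2 := by gcongr
        _ = _ := by ring
  · intro n
    by_cases hn : n ∈ F.byz
    · simp [hq n hn]
    · rw [integral_sample, ← Finset.smul_sum, sum_stochGrad_sub hdiff hn]
      simp

end RoundError

/-! ### Expected error of the good messages for a frozen model -/

section RoundBound

variable {p N G m s : ℕ} {Ξ : Type*} {F : Federation p N Ξ}

/-- The deviation, scaled by `-η`, of the local gradient of client `n` from the gradient of the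
global loss. -/
noncomputable def clientBias (F : Federation p N Ξ) (η : ℝ) (x : Param p) (n : Fin N) : Param p :=
  (-η) • (gradient (F.localLoss n) x - gradient F.globalLoss x)

/-- The average of `clientBias` over a group. -/
noncomputable def groupBias (F : Federation p N Ξ) (m : ℕ) (η : ℝ) (x : Param p)
    (a : Fin N → Fin G) (g : Fin G) : Param p :=
  (1 / (m : ℝ)) • ∑ n ∈ Finset.univ.filter (fun n => a n = g), clientBias F η x n

theorem sum_comp_balanced {a : Fin N → Fin G} (ha : a ∈ balanced (Fin N) G m) (f : Fin G → ℝ) :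
    ∑ n, f (a n) = m * ∑ g, f g := by
  rw [← Finset.sum_fiberwise Finset.univ a, Finset.mul_sum]
  refine Finset.sum_congr rfl fun g _ => ?_
  rw [Finset.sum_congr rfl fun n hn => by rw [(Finset.mem_filter.1 hn).2], Finset.sum_const, ha g,
    nsmul_eq_mul]

theorem sum_smul_groupBias (η : ℝ) (x : Param p) (a : Fin N → Fin G) (q : Fin G → ℝ) :
    ∑ g, q g • groupBias F m η x a g = ∑ n, (q (a n) / m) • clientBias F η x n := by
  rw [← Finset.sum_fiberwise Finset.univ a]
  refine Finset.sum_congr rfl fun g _ => ?_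
  rw [groupBias, smul_smul, Finset.smul_sum]
  refine Finset.sum_congr rfl fun n hn => ?_
  rw [(Finset.mem_filter.1 hn).2, mul_one_div]

/-- The mean squared error of the good messages, averaged over samples and noises. -/
theorem lintegral_sample_noise_le (hm : 0 < m) (hdiff : F.DifferentiableLosses) {κ : ℝ}
    (hinner : F.BoundedInnerVariation κ) (η r σ : ℝ) (x : Param p) {a : Fin N → Fin G}
    (ha : a ∈ balanced (Fin N) G m) (c : Fin G × Fin s → Fin G) :
    ∫⁻ j : ∀ n, Fin (F.size n), ∫⁻ z : Fin G → Param p,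
        ENNReal.ofReal (meanGoodError F m η r x ((a, c, j, z) : Seed F G s))
        ∂(Measure.pi fun _ => multivariateGaussian 0 (σ ^ 2 • (1 : Matrix (Fin p) (Fin p) ℝ)))
        ∂(Measure.pi fun n => uniformOn (Set.univ : Set (Fin (F.size n))))
      ≤ ENNReal.ofReal ((1 / ((goodMessages (honestGroups F.byz a) c).card : ℝ)) *
          ∑ k ∈ goodMessages (honestGroups F.byz a) c,
            (‖∑ g, resampleWeight c k g • groupBias F m η x a g‖ ^ 2
              + (η ^ 2 * κ ^ 2 + r ^ 2 * (p * σ ^ 2)) * ∑ g, resampleWeight c k g ^ 2)) := by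
  set S := goodMessages (honestGroups F.byz a) c with hS
  have hm1 : (1 : ℝ) ≤ m := by exact_mod_cast hm
  let B : Fin G → (∀ n, Fin (F.size n)) → Param p := fun k j =>
    ∑ n, (resampleWeight c k (a n) / m) • clientError F η x n (j n)
  have hΦ : ∀ j z, meanGoodError F m η r x ((a, c, j, z) : Seed F G s)
      = (1 / (S.card : ℝ)) *
        ∑ k ∈ S, ‖B k j + ∑ g, (resampleWeight c k g * r) • z g‖ ^ 2 := by
    intro j z
    unfold meanGoodError
    simp only [sum_weight_smul_groupError]
    rfl
  have hz : ∀ j, ∫⁻ z : Fin G → Param p,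
        ENNReal.ofReal (meanGoodError F m η r x ((a, c, j, z) : Seed F G s))
        ∂(Measure.pi fun _ => multivariateGaussian 0 (σ ^ 2 • (1 : Matrix (Fin p) (Fin p) ℝ)))
      = ENNReal.ofReal ((1 / (S.card : ℝ)) *
        ∑ k ∈ S, (‖B k j‖ ^ 2 + p * σ ^ 2 * ∑ g, (resampleWeight c k g * r) ^ 2)) := by
    intro j
    simp_rw [hΦ]
    rw [← ofReal_integral_eq_lintegral_ofReal
      ((integrable_finsetSum _ fun k _ => integrable_noise _ _ σ).const_mul _)
      (ae_of_all _ fun z => by positivity), integral_const_mul,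
      integral_finsetSum _ fun k _ => integrable_noise _ _ σ]
    simp_rw [integral_noise]
  simp_rw [hz]
  rw [← ofReal_integral_eq_lintegral_ofReal .of_finite (ae_of_all _ fun z => by positivity),
    integral_const_mul, integral_finsetSum _ fun k _ => .of_finite]
  apply ENNReal.ofReal_le_ofReal
  gcongr with k hk
  rw [integral_add .of_finite .of_finite]
  -- A good message gives no weight to a group containing a Byzantine client.
  have hq : ∀ n ∈ F.byz, resampleWeight c k (a n) / m = 0 := by
    intro n hn
    rw [resampleWeight_eq_zero hk, zero_div]
    exact fun h => not_mem_of_mem_honestGroups h hn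
  have h1 := integral_samples_le hdiff hinner η x (fun n => resampleWeight c k (a n) / m) hq
  rw [sum_comp_balanced ha (fun g => (resampleWeight c k g / m) ^ 2)] at h1
  have h2 := sum_smul_groupBias (F := F) (m := m) η x a (resampleWeight c k)
  unfold clientBias at h2
  rw [← h2] at h1
  -- Averaging over a group divides the sampling variance by `m`; this gain is discarded, and `κ²`
  -- enters without `1 / m`.
  have h3 : (m : ℝ) * ∑ g, (resampleWeight c k g / m) ^ 2 ≤ ∑ g, resampleWeight c k g ^ 2 := by
    rw [Finset.mul_sum]
    refine Finset.sum_le_sum fun g _ => ?_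
    have : (m : ℝ) * (resampleWeight c k g / m) ^ 2 = resampleWeight c k g ^ 2 / m := by field_simp
    rw [this]
    exact div_le_self (sq_nonneg _) hm1
  have h4 : ∑ g, (resampleWeight c k g * r) ^ 2 = r ^ 2 * ∑ g, resampleWeight c k g ^ 2 := by
    rw [Finset.mul_sum]
    exact Finset.sum_congr rfl fun g _ => by ring
  rw [h4]
  have h5 := mul_le_mul_of_nonneg_left h3 (by positivity : 0 ≤ η ^ 2 * κ ^ 2)
  simp only [integral_const, probReal_univ, one_smul]
  calc _ ≤ _ := add_le_add_left h1 _
    _ ≤ _ := by linarith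

theorem norm_sum_single_sq (S : Finset (Fin G)) (q : Fin G → ℝ) :
    ‖∑ g ∈ S, q g • (EuclideanSpace.single g (1 : ℝ) : EuclideanSpace ℝ (Fin G))‖ ^ 2
      = ∑ g ∈ S, q g ^ 2 := by
  rw [EuclideanSpace.real_norm_sq_eq]
  have h : ∀ l, (∑ g ∈ S, q g • (EuclideanSpace.single g (1 : ℝ) : EuclideanSpace ℝ (Fin G))) l
      = if l ∈ S then q l else 0 := by
    intro l
    simp [Pi.single_apply]
  simp_rw [h, ite_pow]
  simp

/-- Averaging over the resampling. -/
theorem sum_resampling_bias_le (hs : 0 < s) {H : Finset (Fin G)} (hH : H.Nonempty)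
    (hgood : ∀ c : Fin G × Fin s → Fin G, (goodMessages H c).Nonempty) (e : Fin G → Param p)
    {v : ℝ} (hv : 0 ≤ v) :
    ∑ c ∈ balancedFinset (Fin G × Fin s) G s, (1 / ((goodMessages H c).card : ℝ)) *
        ∑ k ∈ goodMessages H c, (‖∑ g, resampleWeight c k g • e g‖ ^ 2
          + v * ∑ g, resampleWeight c k g ^ 2)
      ≤ (balancedFinset (Fin G × Fin s) G s).card *
        (resampleFactor G s * ((1 / (H.card : ℝ)) * ∑ g ∈ H, ‖e g‖ ^ 2 + v)
          + (1 - resampleFactor G s) * (‖(1 / (H.card : ℝ)) • ∑ g ∈ H, e g‖ ^ 2 + v / H.card)) := by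
  have hh : (0 : ℝ) < H.card := by exact_mod_cast hH.card_pos
  have h1 := sum_resampling_le hs hH hgood e
  -- For orthonormal vectors the squared norm of a weighted sum is the sum of the squared weights,
  -- the mean of the squares is `1` and the square of the mean is `1 / |H|`: this yields the
  -- variance terms.
  have h2 := sum_resampling_le hs hH hgood
    (fun g => (EuclideanSpace.single g (1 : ℝ) : EuclideanSpace ℝ (Fin G)))
  simp_rw [norm_sum_single_sq] at h2
  have h3 : (1 / (H.card : ℝ)) * ∑ g ∈ H,
      ‖(EuclideanSpace.single g (1 : ℝ) : EuclideanSpace ℝ (Fin G))‖ ^ 2 = 1 := by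
    simp; field_simp
  have h4 : ‖(1 / (H.card : ℝ)) • ∑ g ∈ H,
      (EuclideanSpace.single g (1 : ℝ) : EuclideanSpace ℝ (Fin G))‖ ^ 2 = 1 / H.card := by
    rw [Finset.smul_sum, norm_sum_single_sq H fun _ => 1 / (H.card : ℝ), Finset.sum_const,
      nsmul_eq_mul]
    field_simp
  rw [h3, h4] at h2
  have h5 := mul_le_mul_of_nonneg_left h2 hv
  have h6 : ∑ c ∈ balancedFinset (Fin G × Fin s) G s, (1 / ((goodMessages H c).card : ℝ)) *
        ∑ k ∈ goodMessages H c, (‖∑ g, resampleWeight c k g • e g‖ ^ 2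
          + v * ∑ g, resampleWeight c k g ^ 2)
      = ∑ c ∈ balancedFinset (Fin G × Fin s) G s, (1 / ((goodMessages H c).card : ℝ)) *
        ∑ k ∈ goodMessages H c, ‖∑ g, resampleWeight c k g • e g‖ ^ 2
        + v * ∑ c ∈ balancedFinset (Fin G × Fin s) G s, (1 / ((goodMessages H c).card : ℝ)) *
        ∑ k ∈ goodMessages H c, ∑ g, resampleWeight c k g ^ 2 := by
    rw [Finset.mul_sum, ← Finset.sum_add_distrib]
    refine Finset.sum_congr rfl fun c _ => ?_
    rw [Finset.sum_add_distrib, ← Finset.mul_sum]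
    ring
  rw [h6]
  refine (add_le_add h1 h5).trans (le_of_eq ?_)
  ring

theorem norm_clientBias_sq_le {δ : ℝ} (houter : F.BoundedOuterVariation δ) (η : ℝ) (x : Param p)
    {n : Fin N} (hn : n ∉ F.byz) : ‖clientBias F η x n‖ ^ 2 ≤ η ^ 2 * δ ^ 2 := by
  rw [clientBias, norm_smul, mul_pow, Real.norm_eq_abs, sq_abs, neg_sq]
  exact mul_le_mul_of_nonneg_left (houter n hn x) (sq_nonneg η)

theorem norm_groupBias_sq_le (hm : 0 < m) {δ : ℝ} (houter : F.BoundedOuterVariation δ) (η : ℝ)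
    (x : Param p) {a : Fin N → Fin G} (ha : a ∈ balanced (Fin N) G m) {g : Fin G}
    (hg : g ∈ honestGroups F.byz a) : ‖groupBias F m η x a g‖ ^ 2 ≤ η ^ 2 * δ ^ 2 := by
  have hm0 : (0 : ℝ) < m := by exact_mod_cast hm
  have h1 := norm_average_sq_le (Finset.univ.filter (fun n => a n = g)) (clientBias F η x)
  rw [ha g] at h1
  refine h1.trans ?_
  have h2 : ∑ n ∈ Finset.univ.filter (fun n => a n = g), ‖clientBias F η x n‖ ^ 2
      ≤ m * (η ^ 2 * δ ^ 2) := by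
    have h3 : ∀ n ∈ Finset.univ.filter (fun n => a n = g),
        ‖clientBias F η x n‖ ^ 2 ≤ η ^ 2 * δ ^ 2 := fun n hn =>
      norm_clientBias_sq_le houter η x
        (not_mem_of_mem_honestGroups ((Finset.mem_filter.1 hn).2 ▸ hg))
    have h4 := Finset.sum_le_card_nsmul _ _ _ h3
    rwa [ha g, nsmul_eq_mul] at h4
  calc _ ≤ 1 / (m : ℝ) * (m * (η ^ 2 * δ ^ 2)) := by gcongr
    _ = _ := by field_simp

/-- At most `sB < G / 2` of the `G` messages are bad. -/
theorem goodMessages_nonempty (hB : 2 * (s * F.byz.card) < G) (a : Fin N → Fin G)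
    (c : Fin G × Fin s → Fin G) : (goodMessages (honestGroups F.byz a) c).Nonempty := by
  rw [← Finset.card_pos]
  have h1 := card_compl_goodMessages_le (honestGroups F.byz a) c
  have h2 := Nat.mul_le_mul_left s (card_compl_honestGroups_le F.byz a)
  have h3 := Finset.card_add_card_compl (goodMessages (honestGroups F.byz a) c)
  rw [Fintype.card_fin] at h3
  omega

/-- The expected mean squared error of the good messages of one round. -/
theorem lintegral_meanGoodError_le (hN : N = G * m) (hm : 0 < m) (hs : 0 < s)
    (hB : 2 * (s * F.byz.card) < G) (hdiff : F.DifferentiableLosses) {δ κ : ℝ}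
    (houter : F.BoundedOuterVariation δ) (hinner : F.BoundedInnerVariation κ) (η r σ : ℝ)
    (x : Param p) :
    ∫⁻ ζ, ENNReal.ofReal (meanGoodError F m η r x ζ) ∂(seedLaw F G m s σ)
      ≤ ENNReal.ofReal ((resampleFactor G s + (1 - resampleFactor G s) / ((G : ℝ) - F.byz.card)) *
          (η ^ 2 * δ ^ 2 + (η ^ 2 * κ ^ 2 + r ^ 2 * (p * σ ^ 2)))) := by
  have hBG : F.byz.card < G := by
    have := Nat.le_mul_of_pos_left F.byz.card hs
    omega
  have hBG' : (F.byz.card : ℝ) < G := by exact_mod_cast hBG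
  have hG : 0 < G := by omega
  have hd0 : 0 ≤ resampleFactor G s := resampleFactor_nonneg hs
  have hd1 : 0 ≤ 1 - resampleFactor G s := by linarith [resampleFactor_le_one (G := G) hG hs]
  set d := resampleFactor G s
  set v := η ^ 2 * κ ^ 2 + r ^ 2 * (p * σ ^ 2) with hv
  have hv0 : 0 ≤ v := by positivity
  have hmeas : Measurable fun ζ : Seed F G s => ENNReal.ofReal (meanGoodError F m η r x ζ) :=
    ((measurable_meanGoodError F m η r).comp measurable_prodMk_left).ennreal_ofReal
  have hmeas₁ : ∀ a, Measurable fun y => ENNReal.ofReal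
      (meanGoodError F m η r x ((a, y) : Seed F G s)) := fun a => hmeas.comp measurable_prodMk_left
  have hmeas₂ : ∀ a c, Measurable fun y => ENNReal.ofReal
      (meanGoodError F m η r x ((a, c, y) : Seed F G s)) := fun a c =>
    (hmeas₁ a).comp measurable_prodMk_left
  -- The bound for a fixed division, after averaging over noises, samples and resampling. Only the
  -- squared mean of the group biases still depends on the division.
  let R : (Fin N → Fin G) → ℝ := fun a => d * (η ^ 2 * δ ^ 2 + v) + (1 - d) *
    (‖(1 / ((honestGroups F.byz a).card : ℝ)) •
      ∑ g ∈ honestGroups F.byz a, groupBias F m η x a g‖ ^ 2 + v / ((G : ℝ) - F.byz.card))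
  have hR0 : ∀ a, 0 ≤ R a := fun a => by
    have : (0 : ℝ) < G - F.byz.card := by linarith
    positivity
  have hH0 : ∀ a : Fin N → Fin G, (0 : ℝ) < (honestGroups F.byz a).card := fun a => by
    have := sub_card_le_card_honestGroups F.byz a
    linarith
  have hcC : (0 : ℝ) < (balancedFinset (Fin G × Fin s) G s).card := by
    have := balanced_nonempty (ι := Fin G × Fin s) (G := G) (k := s) (by simp)
    rw [← coe_balancedFinset, Finset.coe_nonempty] at this
    exact_mod_cast this.card_pos
  have hcA : (0 : ℝ) < (balancedFinset (Fin N) G m).card := by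
    have := balanced_nonempty (ι := Fin N) (G := G) (k := m) (by simp [hN])
    rw [← coe_balancedFinset, Finset.coe_nonempty] at this
    exact_mod_cast this.card_pos
  have hres : ∀ a ∈ balanced (Fin N) G m,
      ∫⁻ ζ, ENNReal.ofReal (meanGoodError F m η r x ((a, ζ) : Seed F G s))
        ∂((uniformOn (balanced (Fin G × Fin s) G s)).prod <|
          (Measure.pi fun n => uniformOn (Set.univ : Set (Fin (F.size n)))).prod <|
          Measure.pi fun _ : Fin G =>
            multivariateGaussian 0 (σ ^ 2 • (1 : Matrix (Fin p) (Fin p) ℝ)))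
        ≤ ENNReal.ofReal (R a) := by
    intro a ha
    have hHne : (honestGroups F.byz a).Nonempty := by
      rw [← Finset.card_pos]; exact_mod_cast hH0 a
    rw [lintegral_prod _ (hmeas₁ a).aemeasurable]
    have h1 : ∀ c : Fin G × Fin s → Fin G,
        ∫⁻ ζ, ENNReal.ofReal (meanGoodError F m η r x ((a, c, ζ) : Seed F G s))
        ∂((Measure.pi fun n => uniformOn (Set.univ : Set (Fin (F.size n)))).prod <|
          Measure.pi fun _ : Fin G =>
            multivariateGaussian 0 (σ ^ 2 • (1 : Matrix (Fin p) (Fin p) ℝ)))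
        ≤ ENNReal.ofReal ((1 / ((goodMessages (honestGroups F.byz a) c).card : ℝ)) *
          ∑ k ∈ goodMessages (honestGroups F.byz a) c,
            (‖∑ g, resampleWeight c k g • groupBias F m η x a g‖ ^ 2
              + v * ∑ g, resampleWeight c k g ^ 2)) := by
      intro c
      rw [lintegral_prod _ (hmeas₂ a c).aemeasurable]
      exact lintegral_sample_noise_le hm hdiff hinner η r σ x ha c
    refine (lintegral_mono h1).trans ?_
    rw [← coe_balancedFinset, lintegral_uniformOn _ _ fun c => by positivity]
    apply ENNReal.ofReal_le_ofReal
    have h2 := sum_resampling_bias_le hs hHne (goodMessages_nonempty hB a)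
      (groupBias F m η x a) hv0
    have h3 : (1 / ((honestGroups F.byz a).card : ℝ)) *
        ∑ g ∈ honestGroups F.byz a, ‖groupBias F m η x a g‖ ^ 2 ≤ η ^ 2 * δ ^ 2 := by
      rw [one_div_mul_eq_div, div_le_iff₀ (hH0 a), mul_comm, ← nsmul_eq_mul]
      exact Finset.sum_le_card_nsmul _ _ _ fun g hg => norm_groupBias_sq_le hm houter η x ha hg
    have h4 : v / (honestGroups F.byz a).card ≤ v / ((G : ℝ) - F.byz.card) := by
      have := sub_card_le_card_honestGroups F.byz a
      apply div_le_div_of_nonneg_left hv0 (by linarith) this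
    rw [one_div_mul_eq_div, div_le_iff₀ hcC]
    refine h2.trans ?_
    rw [mul_comm]
    refine mul_le_mul_of_nonneg_right ?_ hcC.le
    exact add_le_add (mul_le_mul_of_nonneg_left (by linarith) hd0)
      (mul_le_mul_of_nonneg_left (by linarith) hd1)
  rw [seedLaw, lintegral_prod _ hmeas.aemeasurable]
  refine (lintegral_mono_ae ((ae_mem_uniformOn _).mono hres)).trans ?_
  rw [← coe_balancedFinset, lintegral_uniformOn _ _ hR0]
  apply ENNReal.ofReal_le_ofReal
  rw [one_div_mul_eq_div, div_le_iff₀ hcA]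
  -- The average over divisions supplies the missing factor `1 / (G - B)` for the bias, so bias and
  -- variance carry the same coefficient.
  have hbias := sum_grouping_le (G := G) hm hBG' (clientBias F η x)
    (by
      unfold clientBias
      rw [← Finset.smul_sum, sum_gradient_localLoss_sub hdiff, smul_zero])
    (fun n hn => norm_clientBias_sq_le houter η x hn) (by positivity)
  have h5 := mul_le_mul_of_nonneg_left hbias hd1
  simp only [R]
  rw [Finset.sum_add_distrib, ← Finset.mul_sum _ _ (1 - d), Finset.sum_add_distrib,
    Finset.sum_const, Finset.sum_const, nsmul_eq_mul, nsmul_eq_mul]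
  calc _ ≤ (balancedFinset (Fin N) G m).card * (d * (η ^ 2 * δ ^ 2 + v)) + (1 - d) *
        ((balancedFinset (Fin N) G m).card * (η ^ 2 * δ ^ 2 / (G - F.byz.card))
          + (balancedFinset (Fin N) G m).card * (v / (G - F.byz.card))) := by
        unfold groupBias
        linarith
    _ = _ := by ring

end RoundBound

/-! ### From the received signals to the median error -/

section OneRound

variable {p N G m s : ℕ} {Ξ : Type*} {F : Federation p N Ξ}

theorem transmitters_eq {hmin : ℝ} {h : Fin N → ℝ} (hh : ∀ n, hmin < h n) (ζ : Seed F G s)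
    (g : Fin G) :
    transmitters F hmin h ζ g = Finset.univ.filter fun n => ζ.group n = g := by
  simp [transmitters, hh]

theorem modelUpdate_eq (η : ℝ) (n : Fin N) (j : Fin (F.size n)) (x : Param p) :
    F.modelUpdate η n j x = (-η) • F.stochGrad n j x := by
  simp [Federation.modelUpdate, Federation.sgdStep]

/-- The error of the update of a group without Byzantine clients. -/
theorem groupUpdate_sub (hm : 0 < m) {ρ hmin : ℝ} (hρ : ρ ≠ 0) (hhmin : hmin ≠ 0) {h : Fin N → ℝ}
    (hh : ∀ n, hmin < h n) (η : ℝ) (attack : Fin N → Param p) (x : Param p) {ζ : Seed F G s}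
    (hζ : ζ.group ∈ balanced (Fin N) G m) {g : Fin G} (hg : g ∈ honestGroups F.byz ζ.group) :
    groupUpdate F η ρ hmin h attack x ζ g - (-η) • gradient F.globalLoss x
      = groupError F m η (1 / (ρ * hmin * m)) x ζ g := by
  have hm0 : (m : ℝ) ≠ 0 := by exact_mod_cast hm.ne'
  have h1 : ∑ n ∈ Finset.univ.filter (fun n => ζ.group n = g),
      (ρ * hmin) • message F η attack x ζ n
      = (ρ * hmin) • ∑ n ∈ Finset.univ.filter (fun n => ζ.group n = g),
        ((-η) • F.stochGrad n (ζ.sample n) x) := by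
    rw [Finset.smul_sum]
    refine Finset.sum_congr rfl fun n hn => ?_
    have hn' : n ∉ F.byz := not_mem_of_mem_honestGroups ((Finset.mem_filter.1 hn).2 ▸ hg)
    rw [message, if_neg hn', modelUpdate_eq]
  have h2 : ∑ n ∈ Finset.univ.filter (fun n => ζ.group n = g), clientError F η x n (ζ.sample n)
      = ∑ n ∈ Finset.univ.filter (fun n => ζ.group n = g), ((-η) • F.stochGrad n (ζ.sample n) x)
        - (m : ℝ) • (-η) • gradient F.globalLoss x := by
    simp only [clientError, smul_sub, Finset.sum_sub_distrib, Finset.sum_const]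
    rw [hζ g, Nat.cast_smul_eq_nsmul ℝ]
  rw [groupUpdate, received, transmitters_eq hh, hζ g, h1, groupError, h2, smul_add, smul_smul,
    smul_sub, smul_smul (1 / (m : ℝ)) (m : ℝ), one_div_mul_cancel hm0, one_smul]
  have h3 : 1 / (ρ * hmin * m) * (ρ * hmin) = 1 / (m : ℝ) := by field_simp
  rw [h3]
  abel

/-- The resampling weights sum to one, so the target can be subtracted inside the average; corrupted
groups have weight zero, so the attack vanishes from the right-hand side. -/
theorem resampled_groupUpdate_sub (hm : 0 < m) (hs : 0 < s) {ρ hmin : ℝ} (hρ : ρ ≠ 0)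
    (hhmin : hmin ≠ 0) {h : Fin N → ℝ} (hh : ∀ n, hmin < h n) (η : ℝ) (attack : Fin N → Param p)
    (x : Param p) {ζ : Seed F G s} (hζ : ζ.group ∈ balanced (Fin N) G m)
    (hc : ζ.resample ∈ balanced (Fin G × Fin s) G s) {k : Fin G}
    (hk : k ∈ goodMessages (honestGroups F.byz ζ.group) ζ.resample) :
    resampled ζ.resample (groupUpdate F η ρ hmin h attack x ζ) k - (-η) • gradient F.globalLoss x
      = ∑ g, resampleWeight ζ.resample k g • groupError F m η (1 / (ρ * hmin * m)) x ζ g := by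
  have h1 : (-η) • gradient F.globalLoss x
      = ∑ g, resampleWeight ζ.resample k g • ((-η) • gradient F.globalLoss x) := by
    rw [← Finset.sum_smul, sum_resampleWeight hs hc, one_smul]
  rw [resampled, ← sum_resampleWeight_smul, h1, ← Finset.sum_sub_distrib]
  refine Finset.sum_congr rfl fun g _ => ?_
  by_cases hg : g ∈ honestGroups F.byz ζ.group
  · rw [← smul_sub, groupUpdate_sub hm hρ hhmin hh η attack x hζ hg]
  · simp [resampleWeight_eq_zero hk hg]

/-- The squared error of the geometric median in one round, whatever the attack. -/
theorem norm_geomMedian_sub_sq_le (hm : 0 < m) (hs : 0 < s) (hB : 2 * (s * F.byz.card) < G)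
    {ρ hmin : ℝ} (hρ : ρ ≠ 0) (hhmin : hmin ≠ 0) {h : Fin N → ℝ} (hh : ∀ n, hmin < h n) (η : ℝ)
    (attack : Fin N → Param p) (x : Param p) {ζ : Seed F G s}
    (hζ : ζ.group ∈ balanced (Fin N) G m) (hc : ζ.resample ∈ balanced (Fin G × Fin s) G s)
    {z : Param p}
    (hz : IsGeomMedian (resampled ζ.resample (groupUpdate F η ρ hmin h attack x ζ)) z) :
    ‖z - (-η) • gradient F.globalLoss x‖ ^ 2
      ≤ medianConst (s * (F.byz.card / G)) ^ 2
        * meanGoodError F m η (1 / (ρ * hmin * m)) x ζ := by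
  have hB' : 2 * ((s : ℝ) * F.byz.card) < G := by exact_mod_cast hB
  have hS : (((goodMessages (honestGroups F.byz ζ.group) ζ.resample)ᶜ.card : ℕ) : ℝ)
      ≤ s * F.byz.card := by
    have h1 := card_compl_goodMessages_le (honestGroups F.byz ζ.group) ζ.resample
    have h2 := Nat.mul_le_mul_left s (card_compl_honestGroups_le F.byz ζ.group)
    exact_mod_cast h1.trans h2
  have h1 := hz.norm_sub_sq_le (goodMessages (honestGroups F.byz ζ.group) ζ.resample)
    ((-η) • gradient F.globalLoss x) hB' hS
  rw [mul_div_assoc] at h1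
  refine h1.trans (le_of_eq ?_)
  rw [meanGoodError]
  congr 2
  exact Finset.sum_congr rfl fun k hk => by
    rw [resampled_groupUpdate_sub hm hs hρ hhmin hh η attack x hζ hc hk]

/-- The degenerate round: with power scale `0` the coefficient of every group update is `1 / 0 = 0`,
so all messages vanish, and `0` is the only median of zeros. -/
theorem geomMedian_eq_zero (hG : 0 < G) {hmin : ℝ} {h : Fin N → ℝ} (η : ℝ)
    (attack : Fin N → Param p) (x : Param p) {ζ : Seed F G s} {z : Param p}
    (hz : IsGeomMedian (resampled ζ.resample (groupUpdate F η 0 hmin h attack x ζ)) z) : z = 0 := by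
  have h0 : ∀ k, resampled ζ.resample (groupUpdate F η 0 hmin h attack x ζ) k = 0 := by
    intro k
    simp [resampled, groupUpdate]
  have h1 := hz.norm_sub_le Finset.univ 0
  simp only [h0, sub_zero, norm_zero, Finset.sum_const_zero, mul_zero, Finset.compl_univ,
    Finset.card_empty, Nat.cast_zero, Finset.card_univ, Fintype.card_fin] at h1
  have hG' : (0 : ℝ) < G := by exact_mod_cast hG
  have h2 : ‖z‖ ≤ 0 := by
    by_contra hcon
    push Not at hcon
    nlinarith
  exact norm_le_zero_iff.1 h2

end OneRound

/-! ### Marginals of the law of the seed -/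

section SeedLaw

variable {p N G m s : ℕ} {Ξ : Type*} (F : Federation p N Ξ)

theorem ae_seedLaw_balanced (σ : ℝ) : ∀ᵐ ζ ∂(seedLaw F G m s σ),
    ζ.group ∈ balanced (Fin N) G m ∧ ζ.resample ∈ balanced (Fin G × Fin s) G s := by
  have h1 : ∀ᵐ ζ ∂(seedLaw F G m s σ), ζ.1 ∈ balanced (Fin N) G m :=
    Measure.quasiMeasurePreserving_fst.ae (ae_mem_uniformOn _)
  have h2 : ∀ᵐ ζ ∂(seedLaw F G m s σ), ζ.2.1 ∈ balanced (Fin G × Fin s) G s :=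
    Measure.quasiMeasurePreserving_snd.ae
      (Measure.quasiMeasurePreserving_fst.ae (ae_mem_uniformOn _))
  exact h1.and h2

theorem isProbabilityMeasure_uniformOn_balanced {ι : Type*} [Fintype ι] {k : ℕ}
    (h : Fintype.card ι = G * k) : IsProbabilityMeasure (uniformOn (balanced ι G k)) :=
  isProbabilityMeasure_uniformOn (Set.toFinite _) (balanced_nonempty h)

theorem measurePreserving_sample (hN : N = G * m) (σ : ℝ) (n : Fin N) :
    MeasurePreserving (fun ζ : Seed F G s => ζ.sample n) (seedLaw F G m s σ)
      (uniformOn (Set.univ : Set (Fin (F.size n)))) := by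
  have := isProbabilityMeasure_uniformOn_balanced (G := G) (ι := Fin N) (k := m) (by simp [hN])
  have := isProbabilityMeasure_uniformOn_balanced (G := G) (ι := Fin G × Fin s) (k := s) (by simp)
  exact (measurePreserving_eval (fun n => uniformOn (Set.univ : Set (Fin (F.size n)))) n).comp
    (measurePreserving_fst.comp (measurePreserving_snd.comp measurePreserving_snd))

theorem uniformOn_univ_singleton_ne_zero {α : Type*} [MeasurableSpace α]
    [MeasurableSingletonClass α] [Finite α] (a : α) : uniformOn (Set.univ : Set α) {a} ≠ 0 := by
  rw [Ne, uniformOn_eq_zero_iff (Set.toFinite _)]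
  simp

end SeedLaw

/-! ### Estimates along a run -/

section Run

variable {p N G m s : ℕ} {Ξ Ω : Type*} [mΩ : MeasurableSpace Ω] {Pr : Measure Ω}
  {F : Federation p N Ξ}

/-- The largest mean squared norm of the honest model updates. -/
noncomputable def maxUpdate (Pr : Measure Ω) (F : Federation p N Ξ) (η : ℝ) (ζ : Ω → Seed F G s)
    (w : Ω → Param p) : ℝ :=
  ⨆ n : {n : Fin N // n ∉ F.byz}, ∫ ω, ‖F.modelUpdate η n ((ζ ω).sample n) (w ω)‖ ^ 2 ∂Pr

theorem powerScale_eq (η P : ℝ) (ζ : Ω → Seed F G s) (w : Ω → Param p) :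
    powerScale Pr F η P ζ w = √(P / maxUpdate Pr F η ζ w) := rfl

theorem integral_norm_modelUpdate_sq (Pr : Measure Ω) (η : ℝ) (ζ : Ω → Seed F G s)
    (w : Ω → Param p) (n : Fin N) :
    ∫ ω, ‖F.modelUpdate η n ((ζ ω).sample n) (w ω)‖ ^ 2 ∂Pr
      = η ^ 2 * ∫ ω, ‖F.stochGrad n ((ζ ω).sample n) (w ω)‖ ^ 2 ∂Pr := by
  simp_rw [modelUpdate_eq, norm_smul, mul_pow, Real.norm_eq_abs, sq_abs, neg_sq]
  rw [integral_const_mul]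

theorem maxUpdate_nonneg (Pr : Measure Ω) (η : ℝ) (ζ : Ω → Seed F G s) (w : Ω → Param p) :
    0 ≤ maxUpdate Pr F η ζ w :=
  Real.iSup_nonneg fun _ => integral_nonneg fun _ => by positivity

theorem maxUpdate_le {K η : ℝ} {ζ : Ω → Seed F G s} {w : Ω → Param p}
    (hK : ∀ n ∉ F.byz, ∫ ω, ‖F.stochGrad n ((ζ ω).sample n) (w ω)‖ ^ 2 ∂Pr ≤ K ^ 2) :
    maxUpdate Pr F η ζ w ≤ η ^ 2 * K ^ 2 := by
  refine Real.iSup_le (fun n => ?_) (by positivity)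
  rw [integral_norm_modelUpdate_sq]
  exact mul_le_mul_of_nonneg_left (hK n n.2) (sq_nonneg η)

/-- By the choice of `ρ_t` the rescaled noise has variance proportional to the largest honest second
moment `M ≤ η²K²`. Of the factor `1 / m²` only `1 / m` is kept. -/
theorem noise_variance_le (hm : 0 < m) {P hmin M η K σ : ℝ} (hP : 0 < P) (hh : 0 < hmin)
    (hM0 : 0 ≤ M) (hM : M ≤ η ^ 2 * K ^ 2) :
    (1 / (√(P / M) * hmin * m)) ^ 2 * (p * σ ^ 2)
      ≤ η ^ 2 * (p * σ ^ 2 / (m * P * hmin ^ 2) * K ^ 2) := by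
  have hm1 : (1 : ℝ) ≤ m := by exact_mod_cast hm
  have hm0 : (0 : ℝ) < m := by linarith
  have h1 : (1 / (√(P / M) * hmin * m)) ^ 2 = M / (P * hmin ^ 2 * m ^ 2) := by
    rw [div_pow, mul_pow, mul_pow, Real.sq_sqrt (by positivity)]
    rcases hM0.eq_or_lt with h | h
    · simp [← h]
    · field_simp
  rw [h1]
  calc M / (P * hmin ^ 2 * m ^ 2) * (p * σ ^ 2)
      ≤ η ^ 2 * K ^ 2 / (P * hmin ^ 2 * m ^ 2) * (p * σ ^ 2) := by gcongr
    _ ≤ η ^ 2 * K ^ 2 / (P * hmin ^ 2 * m) * (p * σ ^ 2) := by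
        gcongr
        nlinarith
    _ = _ := by ring

theorem measurable_sample (n : Fin N) : Measurable fun y : Seed F G s => y.sample n :=
  (measurable_pi_apply n).comp measurable_snd.snd.fst

variable {η P hmin σ : ℝ} {w₀ : Param p} {𝔽 : Filtration ℕ mΩ} {ζ : ℕ → Ω → Seed F G s}
  {h : ℕ → Ω → Fin N → ℝ} {attack : ℕ → Ω → Fin N → Param p} {w : ℕ → Ω → Param p}

theorem IsRun.measurable (hrun : IsRun Pr F G m s η P hmin σ w₀ 𝔽 ζ h attack w) (t : ℕ) :
    Measurable (w t) :=
  (hrun.adapted t).mono (𝔽.le t) le_rfl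

theorem IsRun.indepFun (hrun : IsRun Pr F G m s η P hmin σ w₀ 𝔽 ζ h attack w) (t : ℕ) :
    IndepFun (w t) (ζ t) Pr := by
  have h1 := hrun.seed_indep t
  rw [IndepFun_iff_Indep]
  exact (indep_of_indep_of_le_right h1 (hrun.adapted t).comap_le).symm

theorem IsRun.ae_balanced (hrun : IsRun Pr F G m s η P hmin σ w₀ 𝔽 ζ h attack w) (t : ℕ) :
    ∀ᵐ ω ∂Pr, (ζ t ω).group ∈ balanced (Fin N) G m ∧
      (ζ t ω).resample ∈ balanced (Fin G × Fin s) G s := by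
  have h1 := ae_seedLaw_balanced F (G := G) (m := m) (s := s) σ
  rw [← (hrun.seed_law t).map_eq] at h1
  exact ae_of_ae_map (hrun.seed_law t).aemeasurable h1

theorem IsRun.measurable_stochGrad (hrun : IsRun Pr F G m s η P hmin σ w₀ 𝔽 ζ h attack w) (t : ℕ)
    (n : Fin N) : AEMeasurable (fun ω => F.stochGrad n ((ζ t ω).sample n) (w t ω)) Pr := by
  have h1 : Measurable fun y : Param p × Fin (F.size n) => F.stochGrad n y.2 y.1 :=
    measurable_from_prod_countable_left fun j => ROTAF.measurable_stochGrad n j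
  exact h1.comp_aemeasurable ((hrun.measurable t).aemeasurable.prodMk
    ((measurable_sample n).comp_aemeasurable (hrun.seed_law t).aemeasurable))

/-- If the honest clients have nothing to send then the gradient of the global loss vanishes. -/
theorem IsRun.ae_gradient_eq_zero (hrun : IsRun Pr F G m s η P hmin σ w₀ 𝔽 ζ h attack w)
    (hN : N = G * m) (hη : 0 < η) (t : ℕ) (hdiff : F.DifferentiableLosses)
    (hint : ∀ n ∉ F.byz,
      Integrable (fun ω => ‖F.stochGrad n ((ζ t ω).sample n) (w t ω)‖ ^ 2) Pr)
    (hM : maxUpdate Pr F η (ζ t) (w t) = 0) :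
    ∀ᵐ ω ∂Pr, gradient F.globalLoss (w t ω) = 0 := by
  have h1 : ∀ n, n ∉ F.byz → ∀ᵐ ω ∂Pr, F.stochGrad n ((ζ t ω).sample n) (w t ω) = 0 := by
    intro n hn
    have hle : ∫ ω, ‖F.modelUpdate η n ((ζ t ω).sample n) (w t ω)‖ ^ 2 ∂Pr
        ≤ maxUpdate Pr F η (ζ t) (w t) :=
      le_ciSup (f := fun n : {n : Fin N // n ∉ F.byz} =>
        ∫ ω, ‖F.modelUpdate η n ((ζ t ω).sample n) (w t ω)‖ ^ 2 ∂Pr)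
        (Set.finite_range _).bddAbove ⟨n, hn⟩
    rw [hM, integral_norm_modelUpdate_sq] at hle
    have h0 : ∫ ω, ‖F.stochGrad n ((ζ t ω).sample n) (w t ω)‖ ^ 2 ∂Pr = 0 := by
      refine le_antisymm ?_ (integral_nonneg fun _ => by positivity)
      exact nonpos_of_mul_nonpos_right hle (by positivity)
    -- Integrability is essential: the integral of a non-integrable function is also `0` by
    -- convention.
    rw [integral_eq_zero_iff_of_nonneg (fun _ => by positivity) (hint n hn)] at h0
    filter_upwards [h0] with ω hω
    simpa using hω
  have h2 : ∀ n, n ∉ F.byz → ∀ j, ∀ᵐ ω ∂Pr, F.stochGrad n j (w t ω) = 0 := by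
    intro n hn j
    have hS : MeasurableSet {x : Param p | F.stochGrad n j x ≠ 0} :=
      (ROTAF.measurable_stochGrad n j (measurableSet_singleton 0)).compl
    have hJ : MeasurableSet {y : Seed F G s | y.sample n = j} :=
      measurable_sample n (measurableSet_singleton j)
    -- The sample index is independent of `w_t` and takes the value `j` with positive probability,
    -- so vanishing at the drawn index forces vanishing at every index.
    have hind := (hrun.indepFun t).measure_inter_preimage_eq_mul _ _ hS hJ
    have hzero : Pr (w t ⁻¹' {x : Param p | F.stochGrad n j x ≠ 0} ∩
        ζ t ⁻¹' {y : Seed F G s | y.sample n = j}) = 0 := by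
      refine measure_mono_null ?_ (h1 n hn)
      rintro ω ⟨hω, hω'⟩ hcon
      replace hω' : (ζ t ω).sample n = j := hω'
      replace hcon : F.stochGrad n ((ζ t ω).sample n) (w t ω) = 0 := hcon
      rw [hω'] at hcon
      exact hω hcon
    have hpos : Pr (ζ t ⁻¹' {y : Seed F G s | y.sample n = j}) ≠ 0 := by
      have e1 := (hrun.seed_law t).measure_eq hJ
      have e2 := (measurePreserving_sample F (s := s) hN σ n).measure_preimage
        (measurableSet_singleton j).nullMeasurableSet
      have e3 := uniformOn_univ_singleton_ne_zero j
      rw [← e2] at e3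
      change Pr {ω | (ζ t ω).sample n = j} ≠ 0
      rw [e1]
      exact e3
    rw [hzero] at hind
    exact (mul_eq_zero.1 hind.symm).resolve_right hpos
  have h3 : ∀ᵐ ω ∂Pr, ∀ n, n ∉ F.byz → ∀ j, F.stochGrad n j (w t ω) = 0 := by
    rw [ae_all_iff]
    intro n
    by_cases hn : n ∈ F.byz
    · exact ae_of_all _ fun _ h => absurd hn h
    · filter_upwards [ae_all_iff.2 (h2 n hn)] with ω hω _ using hω
  filter_upwards [h3] with ω hω
  rw [gradient_globalLoss hdiff, Finset.sum_eq_zero, smul_zero]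
  intro n hn
  rw [gradient_localLoss hdiff (Finset.mem_compl.1 hn), Finset.sum_eq_zero, smul_zero]
  exact fun j _ => hω n (Finset.mem_compl.1 hn) j

/-- The error of the server update in one round, as an estimate of the exact gradient step. -/
theorem IsRun.ae_norm_update_sub_sq_le (hrun : IsRun Pr F G m s η P hmin σ w₀ 𝔽 ζ h attack w)
    (hN : N = G * m) (hm : 0 < m) (hs : 0 < s) (hB : 2 * (s * F.byz.card) < G) (hη : 0 < η)
    (hP : 0 < P) (hh : 0 < hmin) (t : ℕ) (hdiff : F.DifferentiableLosses)
    (hint : ∀ n ∉ F.byz,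
      Integrable (fun ω => ‖F.stochGrad n ((ζ t ω).sample n) (w t ω)‖ ^ 2) Pr) :
    ∀ᵐ ω ∂Pr, ‖w (t + 1) ω - w t ω - (-η) • gradient F.globalLoss (w t ω)‖ ^ 2
      ≤ medianConst (s * (F.byz.card / G)) ^ 2 * meanGoodError F m η
        (1 / (powerScale Pr F η P (ζ t) (w t) * hmin * m)) (w t ω) (ζ t ω) := by
  -- If the maximum is zero, the server does not move, and the exact gradient step is null almost
  -- surely as well, so the error is zero.
  by_cases hM : maxUpdate Pr F η (ζ t) (w t) = 0
  · filter_upwards [hrun.ae_gradient_eq_zero hN hη t hdiff hint hM, hrun.step t] with ω h1 h2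
    rw [powerScale_eq, hM, div_zero, Real.sqrt_zero] at h2
    have h3 := geomMedian_eq_zero (by omega) η _ _ h2
    rw [h1, h3]
    rw [smul_zero, sub_zero, norm_zero, zero_pow two_ne_zero]
    have := meanGoodError_nonneg F m η
      (1 / (powerScale Pr F η P (ζ t) (w t) * hmin * m)) (w t ω) (ζ t ω)
    positivity
  · have hM' : 0 < maxUpdate Pr F η (ζ t) (w t) :=
      lt_of_le_of_ne (maxUpdate_nonneg Pr η (ζ t) (w t)) (Ne.symm hM)
    have hρ : powerScale Pr F η P (ζ t) (w t) ≠ 0 := by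
      rw [powerScale_eq]
      positivity
    filter_upwards [hrun.ae_balanced t, hrun.step t] with ω h1 h2
    exact norm_geomMedian_sub_sq_le hm hs hB hρ hh.ne' (hrun.channel t ω) η _ _ h1.1 h1.2 h2

variable [IsProbabilityMeasure Pr]

/-- The expected mean squared error of the good messages along the run. -/
theorem IsRun.lintegral_le (hrun : IsRun Pr F G m s η P hmin σ w₀ 𝔽 ζ h attack w) (t : ℕ) {r A : ℝ}
    (hA : ∀ x, ∫⁻ y, ENNReal.ofReal (meanGoodError F m η r x y) ∂(seedLaw F G m s σ)
      ≤ ENNReal.ofReal A) :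
    ∫⁻ ω, ENNReal.ofReal (meanGoodError F m η r (w t ω) (ζ t ω)) ∂Pr ≤ ENNReal.ofReal A := by
  have hw := (hrun.measurable t).aemeasurable (μ := Pr)
  have hζ := (hrun.seed_law t).aemeasurable
  have hmeas := (measurable_meanGoodError F (G := G) (s := s) m η r).ennreal_ofReal
  have h1 : ∫⁻ ω, ENNReal.ofReal (meanGoodError F m η r (w t ω) (ζ t ω)) ∂Pr
      = ∫⁻ q, ENNReal.ofReal (meanGoodError F m η r q.1 q.2)
        ∂(Pr.map fun ω => (w t ω, ζ t ω)) := by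
    rw [lintegral_map' hmeas.aemeasurable (hw.prodMk hζ)]
  have := Measure.isProbabilityMeasure_map hw
  have := Measure.isProbabilityMeasure_map hζ
  -- Independence makes the joint law of model and seed a product, so the bound for a frozen model
  -- integrates over `w_t`.
  rw [h1, (indepFun_iff_map_prod_eq_prod_map_map hw hζ).1 (hrun.indepFun t),
    lintegral_prod _ hmeas.aemeasurable, (hrun.seed_law t).map_eq]
  refine (lintegral_mono hA).trans ?_
  simp

theorem IsRun.integrable_stochGrad (hrun : IsRun Pr F G m s η P hmin σ w₀ 𝔽 ζ h attack w) (t : ℕ)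
    {L δ κ : ℝ} (hlip : F.LipschitzGradient L) (houter : F.BoundedOuterVariation δ)
    (hinner : F.BoundedInnerVariation κ) {wstar : Param p}
    (hstar : IsMinOn F.globalLoss Set.univ wstar)
    (hint : Integrable (fun ω => ‖w t ω - wstar‖ ^ 2) Pr) {n : Fin N} (hn : n ∉ F.byz) :
    Integrable (fun ω => ‖F.stochGrad n ((ζ t ω).sample n) (w t ω)‖ ^ 2) Pr := by
  set c := √(F.size n * κ ^ 2) + |δ|
  refine Integrable.mono' (g := fun ω => 2 * c ^ 2 + 2 * L ^ 2 * ‖w t ω - wstar‖ ^ 2)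
    ((integrable_const _).add (hint.const_mul _))
    ((hrun.measurable_stochGrad t n).norm.pow_const 2).aestronglyMeasurable
    (ae_of_all _ fun ω => ?_)
  have h1 := norm_stochGrad_le hlip houter hinner hstar hn ((ζ t ω).sample n) (w t ω)
  rw [Real.norm_eq_abs, abs_of_nonneg (by positivity)]
  calc ‖F.stochGrad n ((ζ t ω).sample n) (w t ω)‖ ^ 2 ≤ (c + L * ‖w t ω - wstar‖) ^ 2 := by gcongr
    _ ≤ _ := by nlinarith [sq_nonneg (c - L * ‖w t ω - wstar‖)]

end Run

/-! ### The recursion for the mean squared distance -/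

section Convergence

variable {p N G m s : ℕ} {Ξ Ω : Type*} [mΩ : MeasurableSpace Ω] {Pr : Measure Ω}
  [IsProbabilityMeasure Pr] {F : Federation p N Ξ}
  {η P hmin σ : ℝ} {w₀ : Param p} {𝔽 : Filtration ℕ mΩ} {ζ : ℕ → Ω → Seed F G s}
  {h : ℕ → Ω → Fin N → ℝ} {attack : ℕ → Ω → Fin N → Param p} {w : ℕ → Ω → Param p}

theorem asymptoticError_nonneg (hs : 0 < s) {B : ℕ} (hB : B < G) (μ δ κ K σ : ℝ) {P : ℝ}
    (hP : 0 < P) (hmin : ℝ) : 0 ≤ asymptoticError p G m s B μ δ κ K σ P hmin := by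
  have h1 := resampleFactor_nonneg (G := G) hs
  have h2 := resampleFactor_le_one (G := G) (by omega) hs
  have h3 : (0 : ℝ) < (G : ℝ) - B := by
    have : (B : ℝ) < G := by exact_mod_cast hB
    linarith
  have h4 : 0 ≤ (1 - resampleFactor G s) / ((G : ℝ) - B) := div_nonneg (by linarith) h3.le
  unfold asymptoticError
  positivity

/-- The recursion for the mean squared distance to the minimizer. -/
theorem IsRun.integrable_and_integral_le
    (hrun : IsRun Pr F G m s η P hmin σ w₀ 𝔽 ζ h attack w)
    (hN : N = G * m) (hm : 0 < m) (hs : 0 < s) (hB : 2 * (s * F.byz.card) < G)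
    {μ L δ κ K : ℝ} (hμ : 0 < μ) (hL : 0 < L) (hP : 0 < P) (hh : 0 < hmin)
    (hη : 0 < η) (hη' : η < min (μ / (2 * L ^ 2)) (2 / μ))
    (hdiff : F.DifferentiableLosses) (hconv : F.StronglyConvex μ) (hlip : F.LipschitzGradient L)
    (houter : F.BoundedOuterVariation δ) (hinner : F.BoundedInnerVariation κ) {wstar : Param p}
    (hstar : IsMinOn F.globalLoss Set.univ wstar) (hgrad : BoundedStochGrad Pr F ζ w K) (t : ℕ)
    (hint : Integrable (fun ω => ‖w t ω - wstar‖ ^ 2) Pr) :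
    Integrable (fun ω => ‖w (t + 1) ω - wstar‖ ^ 2) Pr ∧
      ∫ ω, ‖w (t + 1) ω - wstar‖ ^ 2 ∂Pr ≤ (1 - η * μ) * ∫ ω, ‖w t ω - wstar‖ ^ 2 ∂Pr
        + η * μ * asymptoticError p G m s F.byz.card μ δ κ K σ P hmin := by
  have hBG : F.byz.card < G := by
    have := Nat.le_mul_of_pos_left F.byz.card hs
    omega
  set r := 1 / (powerScale Pr F η P (ζ t) (w t) * hmin * m) with hr
  set C := medianConst (s * (F.byz.card / G)) with hC
  set D := resampleFactor G s + (1 - resampleFactor G s) / ((G : ℝ) - F.byz.card) with hD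
  have hD0 : 0 ≤ D := by
    have h1 := resampleFactor_nonneg (G := G) hs
    have h2 := resampleFactor_le_one (G := G) (by omega) hs
    have h3 : (F.byz.card : ℝ) < G := by exact_mod_cast hBG
    exact add_nonneg h1 (div_nonneg (by linarith) (by linarith))
  set V := η ^ 2 * δ ^ 2 + (η ^ 2 * κ ^ 2 + r ^ 2 * (p * σ ^ 2)) with hV
  have hV0 : 0 ≤ V := by positivity
  have hVle : V ≤ η ^ 2 * (δ ^ 2 + κ ^ 2 + p * σ ^ 2 / (m * P * hmin ^ 2) * K ^ 2) := by
    have := noise_variance_le (p := p) (σ := σ) (K := K) hm hP hh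
      (maxUpdate_nonneg Pr η (ζ t) (w t)) (maxUpdate_le fun n hn => hgrad n hn t)
    rw [← powerScale_eq, ← hr] at this
    rw [hV]
    linarith
  have hsg : ∀ n ∉ F.byz,
      Integrable (fun ω => ‖F.stochGrad n ((ζ t ω).sample n) (w t ω)‖ ^ 2) Pr := fun n hn =>
    hrun.integrable_stochGrad t hlip houter hinner hstar hint hn
  have hΦle := hrun.lintegral_le t (r := r) (A := D * V) fun x =>
    lintegral_meanGoodError_le hN hm hs hB hdiff houter hinner η r σ x
  set Φ : Ω → ℝ := fun ω => meanGoodError F m η r (w t ω) (ζ t ω) with hΦ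
  have hΦ0 : ∀ ω, 0 ≤ Φ ω := fun ω => meanGoodError_nonneg F m η r _ _
  have hΦm : AEStronglyMeasurable Φ Pr :=
    ((measurable_meanGoodError F m η r).comp_aemeasurable
      ((hrun.measurable t).aemeasurable.prodMk (hrun.seed_law t).aemeasurable)).aestronglyMeasurable
  -- The bound on the Lebesgue integral provides integrability, which then passes to the next
  -- iterate through the pointwise recursion.
  have hΦint : Integrable Φ Pr := by
    refine ⟨hΦm, ?_⟩
    rw [hasFiniteIntegral_iff_ofReal (ae_of_all _ hΦ0)]
    exact hΦle.trans_lt ENNReal.ofReal_lt_top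
  have hΦE : ∫ ω, Φ ω ∂Pr ≤ D * V := by
    rw [integral_eq_lintegral_of_nonneg_ae (ae_of_all _ hΦ0) hΦm]
    exact ENNReal.toReal_le_of_le_ofReal (by positivity) hΦle
  have hae : ∀ᵐ ω ∂Pr, ‖w (t + 1) ω - wstar‖ ^ 2
      ≤ (1 - η * μ) * ‖w t ω - wstar‖ ^ 2 + 2 / (η * μ) * (C ^ 2 * Φ ω) := by
    filter_upwards [hrun.ae_norm_update_sub_sq_le hN hm hs hB hη hP hh t hdiff hsg] with ω hω
    refine (norm_perturbedStep_sub_sq_le hμ hL hη hη' hconv hlip hstar (w t ω) (w (t + 1) ω)).trans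
      ?_
    gcongr
  have hbound : Integrable (fun ω => (1 - η * μ) * ‖w t ω - wstar‖ ^ 2
      + 2 / (η * μ) * (C ^ 2 * Φ ω)) Pr :=
    (hint.const_mul _).add ((hΦint.const_mul _).const_mul _)
  have hnext : Integrable (fun ω => ‖w (t + 1) ω - wstar‖ ^ 2) Pr := by
    refine hbound.mono'
      (((hrun.measurable (t + 1)).sub_const wstar).norm.pow_const 2).aestronglyMeasurable ?_
    filter_upwards [hae] with ω hω
    rwa [Real.norm_eq_abs, abs_of_nonneg (by positivity)]
  refine ⟨hnext, (integral_mono_ae hnext hbound hae).trans ?_⟩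
  rw [integral_add (hint.const_mul _) ((hΦint.const_mul _).const_mul _), integral_const_mul,
    integral_const_mul, integral_const_mul]
  have hfin : 2 / (η * μ) * (C ^ 2 * ∫ ω, Φ ω ∂Pr)
      ≤ η * μ * asymptoticError p G m s F.byz.card μ δ κ K σ P hmin := by
    calc 2 / (η * μ) * (C ^ 2 * ∫ ω, Φ ω ∂Pr)
        ≤ 2 / (η * μ) * (C ^ 2 * (D *
          (η ^ 2 * (δ ^ 2 + κ ^ 2 + p * σ ^ 2 / (m * P * hmin ^ 2) * K ^ 2)))) := by
          gcongr
          exact hΦE.trans (mul_le_mul_of_nonneg_left hVle hD0)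
      -- The price `2/(ημ)` times `η²` equals `ημ · 2/μ²`, which makes `A₂` the fixed point of the
      -- recursion.
      _ = _ := by
          rw [asymptoticError, ← hC, ← hD]
          field_simp
  linarith

/-- The contraction factor is non-negative unless the parameter space is trivial. -/
theorem stepSize_mul_le_one {μ L : ℝ} (hL : 0 < L) (hη : 0 < η)
    (hη' : η < μ / (2 * L ^ 2)) (hconv : F.StronglyConvex μ)
    (hlip : F.LipschitzGradient L) {wstar x : Param p} (hstar : IsMinOn F.globalLoss Set.univ wstar)
    (hx : x ≠ wstar) : η * μ ≤ 1 := by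
  rw [lt_div_iff₀ (by positivity)] at hη'
  have h1 := norm_gradientStep_sub_sq_le hconv hlip hstar hη.le x
  have h2 : 0 < ‖x - wstar‖ ^ 2 := by
    have := norm_pos_iff.2 (sub_ne_zero.2 hx)
    positivity
  -- A contraction factor of squared distances cannot be negative when some `x ≠ w*` exists;
  -- together with `η²L² ≤ ημ/2` this even gives `ημ ≤ 2/3`.
  have h3 : 0 ≤ 1 - 2 * (η * μ) + η ^ 2 * L ^ 2 :=
    nonneg_of_mul_nonneg_left ((sq_nonneg _).trans h1) h2
  nlinarith

end Convergence

end ROTAF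

/-! ### The theorem: unrolling the recursion -/

theorem theorem2 {p N G m s : ℕ} {Ξ Ω : Type*} [mΩ : MeasurableSpace Ω]
    (Pr : Measure Ω) [IsProbabilityMeasure Pr]
    (F : ROTAF.Federation p N Ξ)
    (hN : N = G * m) (hm : 0 < m) (hs : 0 < s)
    (hB : (F.numByz : ℝ) < G / (2 * s))
    (μ L δ κ K σ P hmin η : ℝ) (hμ : 0 < μ) (hL : 0 < L) (hP : 0 < P) (hh : 0 < hmin)
    (hη : 0 < η) (hη' : η < min (μ / (2 * L ^ 2)) (2 / μ))
    (hdiff : F.DifferentiableLosses)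
    (hconv : F.StronglyConvex μ)
    (hlip : F.LipschitzGradient L)
    (houter : F.BoundedOuterVariation δ)
    (hinner : F.BoundedInnerVariation κ)
    (wstar : ROTAF.Param p) (hstar : IsMinOn F.globalLoss Set.univ wstar)
    (w₀ : ROTAF.Param p) (𝔽 : Filtration ℕ mΩ)
    (ζ : ℕ → Ω → ROTAF.Seed F G s) (h : ℕ → Ω → Fin N → ℝ)
    (attack : ℕ → Ω → Fin N → ROTAF.Param p) (w : ℕ → Ω → ROTAF.Param p)
    (hrun : ROTAF.IsRun Pr F G m s η P hmin σ w₀ 𝔽 ζ h attack w)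
    (hgrad : ROTAF.BoundedStochGrad Pr F ζ w K) (t : ℕ) :
    Integrable (fun ω => ‖w t ω - wstar‖ ^ 2) Pr ∧
      ∫ ω, ‖w t ω - wstar‖ ^ 2 ∂Pr ≤
        (1 - η * μ) ^ t *
            (‖w₀ - wstar‖ ^ 2 - ROTAF.asymptoticError p G m s F.numByz μ δ κ K σ P hmin) +
          ROTAF.asymptoticError p G m s F.numByz μ δ κ K σ P hmin := by
  have hs0 : (0 : ℝ) < s := by exact_mod_cast hs
  have hB' : 2 * (s * F.byz.card) < G := by
    rw [lt_div_iff₀ (by positivity)] at hB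
    have h1 : (2 : ℝ) * (s * F.byz.card) < G := by
      calc (2 : ℝ) * (s * F.byz.card) = F.numByz * (2 * s) := by
            simp only [ROTAF.Federation.numByz]; ring
        _ < G := hB
    exact_mod_cast h1
  have hBG : F.byz.card < G := by
    have := Nat.le_mul_of_pos_left F.byz.card hs
    omega
  have hA0 := ROTAF.asymptoticError_nonneg (p := p) (m := m) hs hBG μ δ κ K σ hP hmin
  change _ ∧ _ ≤ (1 - η * μ) ^ t * (‖w₀ - wstar‖ ^ 2
    - ROTAF.asymptoticError p G m s F.byz.card μ δ κ K σ P hmin)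
    + ROTAF.asymptoticError p G m s F.byz.card μ δ κ K σ P hmin
  -- In a one-point space `μ` and `L` are unrelated and `1 - ημ` may be negative. There `B₂ = -A₂`,
  -- and `|1 - ημ| ≤ 1`, by `η < 2/μ`, makes the right-hand side non-negative.
  by_cases htriv : ∀ x : ROTAF.Param p, x = wstar
  · have h0 : ∀ ω, ‖w t ω - wstar‖ ^ 2 = 0 := fun ω => by rw [htriv (w t ω)]; simp
    have hημ : η * μ < 2 := by
      rw [← lt_div_iff₀ hμ]; exact hη'.trans_le (min_le_right _ _)
    have hpow : (1 - η * μ) ^ t ≤ 1 := by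
      refine (le_abs_self _).trans ?_
      rw [abs_pow]
      refine pow_le_one₀ (abs_nonneg _) (abs_le.2 ⟨by linarith, ?_⟩)
      nlinarith [mul_pos hη hμ]
    simp only [h0]
    refine ⟨integrable_zero _ _ _, ?_⟩
    rw [integral_zero, htriv w₀, sub_self, norm_zero]
    nlinarith
  · push Not at htriv
    obtain ⟨x, hx⟩ := htriv
    have hημ := ROTAF.stepSize_mul_le_one hL hη (hη'.trans_le (min_le_left _ _)) hconv hlip hstar hx
    induction t with
    | zero =>
      simp only [hrun.init]
      exact ⟨integrable_const _, by simp⟩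
    | succ t ih =>
      obtain ⟨hint, hle⟩ := ih
      obtain ⟨hint', hle'⟩ := hrun.integrable_and_integral_le hN hm hs hB' hμ hL hP hh hη hη' hdiff
        hconv hlip houter hinner hstar hgrad t hint
      refine ⟨hint', hle'.trans ?_⟩
      -- Multiplying the induction hypothesis by `1 - ημ` preserves it because `ημ ≤ 1`; the two
      -- multiples of `A₂` then add up to `A₂`.
      have := mul_le_mul_of_nonneg_left hle (sub_nonneg.2 hημ)
      rw [pow_succ]
      linarith
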